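/- All posets are finite. Let $P$ be a finite poset with least element $\hat 0$ and greatest element $\hat 1$ that is graded, with rank function $\rho$ ($\rho(\hat 0)=0$, and $\rho(y)=\rho(x)+1$ whenever $y$ covers $x$), and let $n=\rho(\hat 1)$ be its rank. Call $P$ *Eulerian* if every interval $[x,y]$ with $x<y$ has as many elements of even rank as of odd rank, and *triangular* if the number of maximal chains of an interval $[x,y]$ depends only on $\rho(x)$ and $\rho(y)$. Let $B_n$ be the lattice of all subsets of $\{1,\dots,n\}$ ordered by inclusion and, for an integer $\alpha\ge 1$, let $\boxplus^{\alpha}(B_n)$ be the poset obtained from $\alpha$ disjoint copies of $B_n$ by identifying all their least elements and identifying all their greatest elements. **Theorem.** Let $P$ be an Eulerian triangular poset of rank $n\ge 4$ such that every interval $[x,y]$ of $P$ with $\rho(y)=\rho(x)+3$ has exactly $6$ maximal chains. If $n$ is odd, then there is an integer $\alpha\ge 1$ such that $P$ is isomorphic to $\boxplus^{\alpha}(B_n)$. If $n$ is even, then $P$ is isomorphic to $B_n$. -/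

import Mathlib

/-- A graded poset is Eulerian if every non-singleton interval `[x, y]` has as many elements
of even rank as of odd rank. (`grade ℕ` is the rank function, with `grade ℕ ⊥ = 0`.) -/
def IsEulerian (P : Type*) [PartialOrder P] [GradeMinOrder ℕ P] : Prop :=
  ∀ x y : P, x < y →
    {z ∈ Set.Icc x y | Even (grade ℕ z)}.ncard = {z ∈ Set.Icc x y | Odd (grade ℕ z)}.ncard

/-- The number of maximal chains of the interval `[x, y]`. -/
noncomputable def numMaxChains {P : Type*} [PartialOrder P] (x y : P) : ℕ :=
  Nat.card (Flag (Set.Icc x y))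

/-- A graded poset is triangular if the number of maximal chains of an interval `[x, y]`
depends only on the rank of `x` and the rank of `y`. -/
def IsTriangular (P : Type*) [PartialOrder P] [GradeMinOrder ℕ P] : Prop :=
  ∀ x y u v : P, x ≤ y → u ≤ v → grade ℕ x = grade ℕ u → grade ℕ y = grade ℕ v →
    numMaxChains x y = numMaxChains u v

/-- The `k`-summation of a poset `Q` with distinct least and greatest elements: the disjoint union
of `k` copies of `Q`, with all the least elements identified and all the greatest elements
identified. The order on the `Σ`-type is that of a disjoint union: elements of different copies
are incomparable. -/
abbrev KSum (k : ℕ) (Q : Type*) [PartialOrder Q] [BoundedOrder Q] : Type _ :=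
  WithBot (WithTop (Σ _ : Fin k, {x : Q // x ≠ ⊥ ∧ x ≠ ⊤}))

/-- The boolean lattice of rank `n`: the subsets of an `n`-element set, ordered by inclusion. -/
abbrev BooleanLattice (n : ℕ) : Type := Finset (Fin n)

/-!
Induction on the rank, starting in rank three, where thinness together with the six maximal chains
forces an interval to be boolean. Suppose that all intervals of an even rank `m` are boolean. Then
an interval of rank `m + 1` consists of boolean lattices glued along their bounds: two atoms
belong to the same copy if and only if they have a common upper bound other than the top element.
In rank `m + 2`, triangularity makes the numbers of atoms and of coatoms of intervals constant, so
double counting determines all level sizes up to two parameters, the numbers `a` and `c` of atoms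
and coatoms. The Euler relation becomes a linear equation in `a` and `c`; it can only hold if the
intervals of rank `m + 1` contain a single boolean copy, and then it gives `a = m + 2`, so that the
intervals of rank `m + 2` are boolean again.
-/

section Grade

variable {P : Type*} [PartialOrder P] [GradeOrder ℕ P] {x y : P}

theorem lt_of_le_of_grade_lt (h : x ≤ y) (hg : grade ℕ x < grade ℕ y) : x < y :=
  h.lt_of_ne fun he => hg.ne (congrArg (grade ℕ) he)

theorem eq_of_le_of_grade_le (h : x ≤ y) (hg : grade ℕ y ≤ grade ℕ x) : x = y :=
  h.eq_of_not_lt fun hlt => (grade_strictMono hlt).not_ge hg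

theorem grade_eq_add_one_of_covBy (h : x ⋖ y) : grade ℕ y = grade ℕ x + 1 :=
  (Nat.covBy_iff_add_one_eq.1 (h.grade ℕ)).symm

theorem covBy_iff_grade_eq_add_one (h : x ≤ y) : x ⋖ y ↔ grade ℕ y = grade ℕ x + 1 := by
  rw [covBy_iff_lt_covBy_grade (𝕆 := ℕ), Nat.covBy_iff_add_one_eq, eq_comm]
  exact and_iff_right_of_imp fun hg => lt_of_le_of_grade_lt h (by omega)

end Grade

section Atoms

variable {P : Type*} [PartialOrder P] [Fintype P] {x y z w a : P}

open Classical in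
/-- The atoms of the interval `[x, y]`. -/
noncomputable def intervalAtoms (x y : P) : Finset P := {a | x ⋖ a ∧ a ≤ y}

theorem mem_intervalAtoms : a ∈ intervalAtoms x y ↔ x ⋖ a ∧ a ≤ y := by
  simp [intervalAtoms]

theorem intervalAtoms_mono (h : z ≤ w) : intervalAtoms x z ⊆ intervalAtoms x w := fun _ ha =>
  mem_intervalAtoms.2 ((mem_intervalAtoms.1 ha).imp_right fun haz => haz.trans h)

theorem intervalAtoms_nonempty (h : x < y) : (intervalAtoms x y).Nonempty := by
  obtain ⟨a, ha⟩ := exists_covBy_le_of_lt h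
  exact ⟨a, mem_intervalAtoms.2 ha⟩

theorem intervalAtoms_self (x : P) : intervalAtoms x x = ∅ :=
  Finset.eq_empty_of_forall_notMem fun _ ha =>
    (mem_intervalAtoms.1 ha).1.lt.not_ge (mem_intervalAtoms.1 ha).2

theorem intervalAtoms_of_covBy (h : x ⋖ y) : intervalAtoms x y = {y} := by
  ext a
  rw [mem_intervalAtoms, Finset.mem_singleton]
  constructor
  · rintro ⟨hxa, hay⟩
    exact hay.eq_of_not_lt (h.2 hxa.lt)
  · rintro rfl
    exact ⟨h, le_rfl⟩

variable [GradeOrder ℕ P]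

theorem lt_of_mem_intervalAtoms (hg : grade ℕ x + 2 ≤ grade ℕ y) (ha : a ∈ intervalAtoms x y) :
    a < y := by
  obtain ⟨hxa, hay⟩ := mem_intervalAtoms.1 ha
  have := grade_eq_add_one_of_covBy hxa
  exact lt_of_le_of_grade_lt hay (by omega)

theorem lt_of_mem_intervalAtoms_of_mem (hg : grade ℕ x + 3 ≤ grade ℕ y)
    (ha : a ∈ intervalAtoms x y) (hz : z ∈ intervalAtoms a y) : z < y := by
  have := grade_eq_add_one_of_covBy (mem_intervalAtoms.1 ha).1
  exact lt_of_mem_intervalAtoms (by omega) hz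

end Atoms

section Levels

variable {P : Type*} [PartialOrder P] [Fintype P] [GradeOrder ℕ P] {x y z : P} {k : ℕ}

open Classical in
/-- The elements of the interval `[x, y]` whose rank in `[x, y]`, that is, relative to `x`,
is `k`. -/
noncomputable def intervalLevel (x y : P) (k : ℕ) : Finset P :=
  {z | z ∈ Set.Icc x y ∧ grade ℕ z = grade ℕ x + k}

theorem mem_intervalLevel :
    z ∈ intervalLevel x y k ↔ z ∈ Set.Icc x y ∧ grade ℕ z = grade ℕ x + k := by
  simp [intervalLevel]

theorem intervalLevel_zero (h : x ≤ y) : intervalLevel x y 0 = {x} := by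
  ext z
  rw [mem_intervalLevel, Finset.mem_singleton]
  constructor
  · rintro ⟨hz, hg⟩
    exact (eq_of_le_of_grade_le hz.1 hg.le).symm
  · rintro rfl
    exact ⟨⟨le_rfl, h⟩, rfl⟩

theorem intervalLevel_one (x y : P) : intervalLevel x y 1 = intervalAtoms x y := by
  ext z
  rw [mem_intervalLevel, mem_intervalAtoms]
  constructor
  · rintro ⟨hz, hg⟩
    exact ⟨(covBy_iff_grade_eq_add_one hz.1).2 hg, hz.2⟩
  · rintro ⟨hxz, hzy⟩
    exact ⟨⟨hxz.le, hzy⟩, grade_eq_add_one_of_covBy hxz⟩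

theorem intervalLevel_top (h : x ≤ y) (hk : grade ℕ y = grade ℕ x + k) :
    intervalLevel x y k = {y} := by
  ext z
  rw [mem_intervalLevel, Finset.mem_singleton]
  constructor
  · rintro ⟨hz, hg⟩
    exact eq_of_le_of_grade_le hz.2 (hk.trans hg.symm).le
  · rintro rfl
    exact ⟨⟨h, le_rfl⟩, hk⟩

theorem sum_card_intervalLevel (x y : P) (k : ℕ) :
    ∑ v ∈ intervalAtoms x y, (intervalLevel v y k).card =
      ∑ z ∈ intervalLevel x y (k + 1), (intervalAtoms x z).card := by
  classical
  convert Finset.sum_card_bipartiteAbove_eq_sum_card_bipartiteBelow (s := intervalAtoms x y)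
    (t := intervalLevel x y (k + 1)) (fun v z : P => v ≤ z) using 2 with v hv z hz
  · have hxv := (mem_intervalAtoms.1 hv).1
    congr 1
    ext z
    simp only [Finset.bipartiteAbove, Finset.mem_filter, mem_intervalLevel, Set.mem_Icc,
      grade_eq_add_one_of_covBy hxv]
    constructor
    · rintro ⟨⟨hvz, hzy⟩, hg⟩
      exact ⟨⟨⟨hxv.le.trans hvz, hzy⟩, by omega⟩, hvz⟩
    · rintro ⟨⟨⟨-, hzy⟩, hg⟩, hvz⟩
      exact ⟨⟨hvz, hzy⟩, by omega⟩
  · have hzy := (mem_intervalLevel.1 hz).1.2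
    congr 1
    ext v
    simp only [Finset.bipartiteBelow, Finset.mem_filter, mem_intervalAtoms]
    exact ⟨fun ⟨hxv, hvz⟩ => ⟨⟨hxv, hvz.trans hzy⟩, hvz⟩, fun ⟨⟨hxv, _⟩, hvz⟩ => ⟨hxv, hvz⟩⟩

end Levels

section BooleanIntervals

variable {P : Type*} [PartialOrder P] [Fintype P] {x y z w a u : P}

/-- The interval `[x, y]` is a boolean lattice. A boolean lattice is recovered from its atoms, so
this is expressed by asking that `z ↦ intervalAtoms x z` be an isomorphism from `[x, y]` to the
subsets of `intervalAtoms x y`. -/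
structure IsBooleanInterval (x y : P) : Prop where
  le_of_intervalAtoms_subset : ∀ z ∈ Set.Icc x y, ∀ w ∈ Set.Icc x y,
    intervalAtoms x z ⊆ intervalAtoms x w → z ≤ w
  exists_intervalAtoms_eq : ∀ T ⊆ intervalAtoms x y, ∃ z ∈ Set.Icc x y, intervalAtoms x z = T

namespace IsBooleanInterval

theorem le (h : IsBooleanInterval x y) : x ≤ y := by
  obtain ⟨z, hz, -⟩ := h.exists_intervalAtoms_eq ∅ (Finset.empty_subset _)
  exact hz.1.trans hz.2

theorem intervalAtoms_injOn (h : IsBooleanInterval x y) :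
    Set.InjOn (intervalAtoms x) (Set.Icc x y) := fun z hz w hw hzw =>
  le_antisymm (h.le_of_intervalAtoms_subset z hz w hw hzw.le)
    (h.le_of_intervalAtoms_subset w hw z hz hzw.ge)

/-- In terms of the lattice structure, `b` is the join of `u` and `a`. -/
theorem exists_intervalAtoms_eq_insert [DecidableEq P] (h : IsBooleanInterval x y)
    (hu : u ∈ Set.Icc x y) (ha : a ∈ intervalAtoms x y) (hau : a ∉ intervalAtoms x u) :
    ∃ b ∈ intervalAtoms u y, intervalAtoms x b = insert a (intervalAtoms x u) := by
  obtain ⟨b, hb, hb_eq⟩ := h.exists_intervalAtoms_eq (insert a (intervalAtoms x u))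
    (Finset.insert_subset ha (intervalAtoms_mono hu.2))
  have hub : u ≤ b := h.le_of_intervalAtoms_subset u hu b hb (hb_eq ▸ Finset.subset_insert _ _)
  refine ⟨b, mem_intervalAtoms.2 ⟨⟨hub.lt_of_ne ?_, fun c huc hcb => ?_⟩, hb.2⟩, hb_eq⟩
  · rintro rfl
    exact hau (hb_eq ▸ Finset.mem_insert_self _ _)
  · have hc : c ∈ Set.Icc x y := ⟨hu.1.trans huc.le, hcb.le.trans hb.2⟩
    have hcov : intervalAtoms x u ⋖ insert a (intervalAtoms x u) := Finset.covBy_insert hau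
    refine hcov.2 (c := intervalAtoms x c) ?_ (hb_eq ▸ ?_)
    · exact (intervalAtoms_mono huc.le).lt_of_ne fun he => huc.ne (h.intervalAtoms_injOn hu hc he)
    · exact (intervalAtoms_mono hcb.le).lt_of_ne fun he => hcb.ne (h.intervalAtoms_injOn hc hb he)

theorem exists_notMem_intervalAtoms (h : IsBooleanInterval x y) (hz : z ∈ Set.Icc x y)
    (hw : w ∈ Set.Icc x y) (hzw : ¬ z ≤ w) : ∃ a ∈ intervalAtoms x z, a ∉ intervalAtoms x w :=
  Finset.not_subset.1 fun hs => hzw (h.le_of_intervalAtoms_subset z hz w hw hs)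

theorem mono_right (h : IsBooleanInterval x y) (hw : w ∈ Set.Icc x y) :
    IsBooleanInterval x w where
  le_of_intervalAtoms_subset z hz z' hz' :=
    h.le_of_intervalAtoms_subset z ⟨hz.1, hz.2.trans hw.2⟩ z' ⟨hz'.1, hz'.2.trans hw.2⟩
  exists_intervalAtoms_eq T hT := by
    obtain ⟨z, hz, rfl⟩ := h.exists_intervalAtoms_eq T (hT.trans (intervalAtoms_mono hw.2))
    exact ⟨z, ⟨hz.1, h.le_of_intervalAtoms_subset z hz w hw hT⟩, rfl⟩

theorem eq_of_mem_intervalAtoms (h : IsBooleanInterval x y) (hu : u ∈ Set.Icc x y)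
    (hz : z ∈ intervalAtoms u y) (hw : w ∈ intervalAtoms u y) (haz : a ∈ intervalAtoms x z)
    (haw : a ∈ intervalAtoms x w) (hau : a ∉ intervalAtoms x u) : z = w := by
  classical
  rw [mem_intervalAtoms] at hz hw
  obtain ⟨b, hb, hb_eq⟩ :=
    h.exists_intervalAtoms_eq_insert hu (intervalAtoms_mono hz.2 haz) hau
  obtain ⟨hub, hby⟩ := mem_intervalAtoms.1 hb
  have eq_of_mem : ∀ d, u ⋖ d → d ≤ y → a ∈ intervalAtoms x d → b = d := fun d hud hdy had =>
    (h.le_of_intervalAtoms_subset b ⟨hu.1.trans hub.le, hby⟩ d ⟨hu.1.trans hud.le, hdy⟩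
      (hb_eq ▸ Finset.insert_subset had (intervalAtoms_mono hud.le))).eq_of_not_lt (hud.2 hub.lt)
  rw [← eq_of_mem z hz.1 hz.2 haz, ← eq_of_mem w hw.1 hw.2 haw]

theorem mono_left (h : IsBooleanInterval x y) (hu : u ∈ Set.Icc x y) :
    IsBooleanInterval u y := by
  classical
  have mem_Icc : ∀ {z}, z ∈ Set.Icc u y → z ∈ Set.Icc x y := fun hz => ⟨hu.1.trans hz.1, hz.2⟩
  refine ⟨fun z hz w hw hs => ?_, fun T hT => ?_⟩
  · refine h.le_of_intervalAtoms_subset z (mem_Icc hz) w (mem_Icc hw) fun a ha => ?_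
    by_cases hau : a ∈ intervalAtoms x u
    · exact intervalAtoms_mono hw.1 hau
    obtain ⟨b, hb, hb_eq⟩ :=
      h.exists_intervalAtoms_eq_insert hu (intervalAtoms_mono hz.2 ha) hau
    obtain ⟨hub, hby⟩ := mem_intervalAtoms.1 hb
    have hbz : b ≤ z := h.le_of_intervalAtoms_subset b (mem_Icc ⟨hub.le, hby⟩) z (mem_Icc hz)
      (hb_eq ▸ Finset.insert_subset ha (intervalAtoms_mono hz.1))
    have hbw : b ≤ w := (mem_intervalAtoms.1 (hs (mem_intervalAtoms.2 ⟨hub, hbz⟩))).2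
    exact intervalAtoms_mono hbw (hb_eq ▸ Finset.mem_insert_self _ _)
  · have hT_Icc : ∀ b ∈ T, b ∈ Set.Icc u y := fun b hb =>
      ⟨(mem_intervalAtoms.1 (hT hb)).1.le, (mem_intervalAtoms.1 (hT hb)).2⟩
    obtain ⟨z, hz, hz_eq⟩ := h.exists_intervalAtoms_eq
      (intervalAtoms x u ∪ T.biUnion (intervalAtoms x))
      (Finset.union_subset (intervalAtoms_mono hu.2)
        (Finset.biUnion_subset.2 fun b hb => intervalAtoms_mono (hT_Icc b hb).2))
    have huz : u ≤ z := h.le_of_intervalAtoms_subset u hu z hz (hz_eq ▸ Finset.subset_union_left)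
    refine ⟨z, ⟨huz, hz.2⟩, Finset.Subset.antisymm (fun b hb => ?_) fun b hb => ?_⟩
    · obtain ⟨hub, hbz⟩ := mem_intervalAtoms.1 hb
      obtain ⟨a, hab, hau⟩ :=
        h.exists_notMem_intervalAtoms (mem_Icc ⟨hub.le, hbz.trans hz.2⟩) hu hub.lt.not_ge
      have haz := intervalAtoms_mono hbz hab
      rw [hz_eq, Finset.mem_union, Finset.mem_biUnion] at haz
      obtain ⟨b', hb'T, hab'⟩ := haz.resolve_left hau
      rw [h.eq_of_mem_intervalAtoms hu (intervalAtoms_mono hz.2 hb) (hT hb'T) hab hab' hau]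
      exact hb'T
    · refine mem_intervalAtoms.2 ⟨(mem_intervalAtoms.1 (hT hb)).1,
        h.le_of_intervalAtoms_subset b (mem_Icc (hT_Icc b hb)) z hz (hz_eq ▸ ?_)⟩
      exact (Finset.subset_biUnion_of_mem _ hb).trans Finset.subset_union_right

variable [GradeOrder ℕ P]

theorem card_intervalAtoms_add_grade (h : IsBooleanInterval x y) :
    (intervalAtoms x y).card + grade ℕ x = grade ℕ y := by
  classical
  induction y using WellFoundedLT.induction with
  | _ y ih =>
    rcases h.le.eq_or_lt with rfl | hxy
    · simp [intervalAtoms_self]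
    obtain ⟨w, hxw, hwy⟩ := exists_le_covBy_of_lt hxy
    have hw : w ∈ Set.Icc x y := ⟨hxw, hwy.le⟩
    obtain ⟨a, hay, haw⟩ :=
      h.exists_notMem_intervalAtoms (Set.right_mem_Icc.2 h.le) hw hwy.lt.not_ge
    obtain ⟨b, hb, hb_eq⟩ := h.exists_intervalAtoms_eq_insert hw hay haw
    rw [intervalAtoms_of_covBy hwy, Finset.mem_singleton] at hb
    rw [← hb, hb_eq, Finset.card_insert_of_notMem haw, hb,
      grade_eq_add_one_of_covBy hwy, ← ih w hwy.lt (h.mono_right hw)]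
    ring

theorem card_intervalLevel (h : IsBooleanInterval x y) (k : ℕ) :
    (intervalLevel x y k).card = (intervalAtoms x y).card.choose k := by
  have hcard : ∀ z ∈ Set.Icc x y, (intervalAtoms x z).card + grade ℕ x = grade ℕ z :=
    fun z hz => (h.mono_right hz).card_intervalAtoms_add_grade
  rw [← Finset.card_powersetCard]
  refine Finset.card_nbij (intervalAtoms x) (fun z hz => ?_) (fun z hz w hw hzw => ?_)
    fun T hT => ?_
  · obtain ⟨hz, hg⟩ := mem_intervalLevel.1 hz
    have := hcard z hz
    exact Finset.mem_powersetCard.2 ⟨intervalAtoms_mono hz.2, by omega⟩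
  · exact h.intervalAtoms_injOn (mem_intervalLevel.1 hz).1 (mem_intervalLevel.1 hw).1 hzw
  · obtain ⟨hT, hk⟩ := Finset.mem_powersetCard.1 hT
    obtain ⟨z, hz, rfl⟩ := h.exists_intervalAtoms_eq T hT
    have := hcard z hz
    exact ⟨z, mem_intervalLevel.2 ⟨hz, by omega⟩, rfl⟩

end IsBooleanInterval

end BooleanIntervals

section SemiBooleanIntervals

variable {P : Type*} [PartialOrder P] [Fintype P] {x y z w v u e : P}

theorem IsBooleanInterval.exists_intervalAtoms_eq_pair [DecidableEq P]
    (h : IsBooleanInterval x y) (hv : v ∈ intervalAtoms x y) (hw : w ∈ intervalAtoms x y)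
    (hvw : v ≠ w) : ∃ e ∈ intervalAtoms v y, intervalAtoms x e = {v, w} := by
  obtain ⟨hxv, hvy⟩ := mem_intervalAtoms.1 hv
  rw [Finset.pair_comm, ← intervalAtoms_of_covBy hxv]
  refine h.exists_intervalAtoms_eq_insert ⟨hxv.le, hvy⟩ hw ?_
  rwa [intervalAtoms_of_covBy hxv, Finset.mem_singleton, eq_comm]

theorem IsBooleanInterval.exists_mem_Ico_of_pair [GradeOrder ℕ P] (h : IsBooleanInterval x y)
    (hg : grade ℕ x + 3 ≤ grade ℕ y) (hv : v ∈ intervalAtoms x y) (hw : w ∈ intervalAtoms x y) :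
    ∃ z ∈ Set.Ico x y, v ≤ z ∧ w ≤ z := by
  classical
  obtain ⟨z, hz, hz_eq⟩ := h.exists_intervalAtoms_eq {v, w}
    (Finset.insert_subset hv (Finset.singleton_subset_iff.2 hw))
  have le_of_mem : ∀ a ∈ ({v, w} : Finset P), a ≤ z := fun a ha =>
    (mem_intervalAtoms.1 (hz_eq ▸ ha)).2
  refine ⟨z, ⟨hz.1, hz.2.lt_of_ne ?_⟩, le_of_mem v (by simp), le_of_mem w (by simp)⟩
  rintro rfl
  have hcard := h.card_intervalAtoms_add_grade
  have hpair := Finset.card_le_two (a := v) (b := w)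
  rw [hz_eq] at hcard
  omega

/-- All proper lower intervals `[x, z]` and all proper upper intervals `[z, y]` of `[x, y]` are
boolean lattices. When its rank is at least four, such an interval consists of boolean lattices
glued along their least and greatest elements. -/
structure IsSemiBooleanInterval (x y : P) : Prop where
  lower : ∀ z ∈ Set.Ico x y, IsBooleanInterval x z
  upper : ∀ z ∈ Set.Ioc x y, IsBooleanInterval z y

theorem IsBooleanInterval.isSemiBooleanInterval (h : IsBooleanInterval x y) :
    IsSemiBooleanInterval x y where
  lower _ hz := h.mono_right ⟨hz.1, hz.2.le⟩
  upper _ hz := h.mono_left ⟨hz.1.le, hz.2⟩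

theorem isSemiBooleanInterval_of_covBy (hatoms : ∀ v, x ⋖ v → v ≤ y → IsBooleanInterval v y)
    (hcoatoms : ∀ w, x ≤ w → w ⋖ y → IsBooleanInterval x w) : IsSemiBooleanInterval x y where
  lower z hz := by
    obtain ⟨w, hzw, hwy⟩ := exists_le_covBy_of_lt hz.2
    exact (hcoatoms w (hz.1.trans hzw) hwy).mono_right ⟨hz.1, hzw⟩
  upper z hz := by
    obtain ⟨v, hxv, hvz⟩ := exists_covBy_le_of_lt hz.1
    exact (hatoms v hxv (hvz.trans hz.2)).mono_left ⟨hvz, hz.2⟩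

open Classical in
/-- The atoms of `[x, y]` which have a common upper bound with `v` other than `y`. In a
semi-boolean interval of rank at least four these are the atoms of the boolean lattice through `v`,
for `v` an atom. -/
noncomputable def atomClass (x y v : P) : Finset P :=
  {w ∈ intervalAtoms x y | ∃ z < y, v ≤ z ∧ w ≤ z}

theorem mem_atomClass :
    w ∈ atomClass x y v ↔ w ∈ intervalAtoms x y ∧ ∃ z < y, v ≤ z ∧ w ≤ z := by
  simp [atomClass]

theorem atomClass_subset : atomClass x y v ⊆ intervalAtoms x y := fun _ hw =>
  (mem_atomClass.1 hw).1

theorem intervalAtoms_subset_atomClass (hzy : z < y) (hvz : v ≤ z) :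
    intervalAtoms x z ⊆ atomClass x y v := fun _ hw =>
  mem_atomClass.2 ⟨intervalAtoms_mono hzy.le hw, z, hzy, hvz, (mem_intervalAtoms.1 hw).2⟩

theorem mem_atomClass_comm (hv : v ∈ intervalAtoms x y) (hw : w ∈ intervalAtoms x y) :
    v ∈ atomClass x y w ↔ w ∈ atomClass x y v := by
  simp only [mem_atomClass, hv, hw, true_and, and_comm]

variable [GradeOrder ℕ P]

theorem mem_atomClass_self (hg : grade ℕ x + 2 ≤ grade ℕ y) (hv : v ∈ intervalAtoms x y) :
    v ∈ atomClass x y v :=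
  mem_atomClass.2 ⟨hv, v, lt_of_mem_intervalAtoms hg hv, le_rfl, le_rfl⟩

namespace IsSemiBooleanInterval

theorem card_intervalLevel_succ (h : IsSemiBooleanInterval x y) {r k : ℕ}
    (hr : grade ℕ y = grade ℕ x + (r + 1)) (hk : k < r) :
    (k + 1) * (intervalLevel x y (k + 1)).card = (intervalAtoms x y).card * r.choose k := by
  have hcount := sum_card_intervalLevel x y k
  rw [Finset.sum_const_nat (m := r.choose k), Finset.sum_const_nat (m := k + 1)] at hcount
  · rw [hcount, mul_comm]
  · intro z hz
    obtain ⟨hz, hgz⟩ := mem_intervalLevel.1 hz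
    have := (h.lower z ⟨hz.1, lt_of_le_of_grade_lt hz.2 (by omega)⟩).card_intervalAtoms_add_grade
    omega
  · intro v hv
    obtain ⟨hxv, hvy⟩ := mem_intervalAtoms.1 hv
    have hB := h.upper v ⟨hxv.lt, hvy⟩
    have hgv := grade_eq_add_one_of_covBy hxv
    have := hB.card_intervalAtoms_add_grade
    rw [hB.card_intervalLevel]
    congr 1
    omega

theorem exists_intervalAtoms_eq_pair [DecidableEq P] (h : IsSemiBooleanInterval x y)
    (hg : grade ℕ x + 3 ≤ grade ℕ y) (hv : v ∈ intervalAtoms x y) (he : e ∈ intervalAtoms v y) :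
    ∃ w ∈ intervalAtoms x y, v ≠ w ∧ intervalAtoms x e = {v, w} := by
  have hey := lt_of_mem_intervalAtoms_of_mem hg hv he
  obtain ⟨hxv, -⟩ := mem_intervalAtoms.1 hv
  obtain ⟨hve, -⟩ := mem_intervalAtoms.1 he
  have hcard := (h.lower e ⟨hxv.le.trans hve.le, hey⟩).card_intervalAtoms_add_grade
  have hgv := grade_eq_add_one_of_covBy hxv
  have hge := grade_eq_add_one_of_covBy hve
  have hv_e : v ∈ intervalAtoms x e := mem_intervalAtoms.2 ⟨hxv, hve.le⟩
  obtain ⟨w, hw⟩ : ∃ w, (intervalAtoms x e).erase v = {w} := by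
    rw [← Finset.card_eq_one, Finset.card_erase_of_mem hv_e]
    omega
  have hw_e : w ∈ (intervalAtoms x e).erase v := hw ▸ Finset.mem_singleton_self w
  refine ⟨w, intervalAtoms_mono hey.le (Finset.mem_of_mem_erase hw_e),
    (Finset.ne_of_mem_erase hw_e).symm, ?_⟩
  rw [← Finset.insert_erase hv_e, hw]

theorem exists_lt_of_mem_intervalAtoms (h : IsSemiBooleanInterval x y)
    (hg : grade ℕ x + 4 ≤ grade ℕ y) (hv : v ∈ intervalAtoms x y) {e' : P}
    (he : e ∈ intervalAtoms v y) (he' : e' ∈ intervalAtoms v y) : ∃ t < y, e ≤ t ∧ e' ≤ t := by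
  obtain ⟨hxv, hvy⟩ := mem_intervalAtoms.1 hv
  have hgv := grade_eq_add_one_of_covBy hxv
  obtain ⟨t, ht, het⟩ :=
    (h.upper v ⟨hxv.lt, hvy⟩).exists_mem_Ico_of_pair (by omega) he he'
  exact ⟨t, ht.2, het⟩

theorem le_iff_le_of_mem_intervalAtoms (h : IsSemiBooleanInterval x y)
    (hg : grade ℕ x + 4 ≤ grade ℕ y) (hv : v ∈ intervalAtoms x y) (hw : w ∈ intervalAtoms x y)
    (hvw : v ≠ w) (he : e ∈ intervalAtoms v y) (hwe : w ≤ e) (hz : z ∈ Set.Icc v y) :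
    w ≤ z ↔ e ≤ z := by
  classical
  refine ⟨fun hwz => ?_, hwe.trans⟩
  obtain ⟨hxv, hvy⟩ := mem_intervalAtoms.1 hv
  obtain ⟨hxw, -⟩ := mem_intervalAtoms.1 hw
  obtain ⟨hve, hey⟩ := mem_intervalAtoms.1 he
  obtain rfl | hzy := hz.2.eq_or_lt
  · exact hey
  obtain ⟨e', he', he'_eq⟩ := (h.lower z ⟨hxv.le.trans hz.1, hzy⟩).exists_intervalAtoms_eq_pair
    (mem_intervalAtoms.2 ⟨hxv, hz.1⟩) (mem_intervalAtoms.2 ⟨hxw, hwz⟩) hvw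
  obtain ⟨hve', he'z⟩ := mem_intervalAtoms.1 he'
  obtain ⟨t, hty, het, he't⟩ :=
    h.exists_lt_of_mem_intervalAtoms hg hv he (intervalAtoms_mono hzy.le he')
  have hle : e' ≤ e := (h.lower t ⟨hxv.le.trans (hve.le.trans het), hty⟩).le_of_intervalAtoms_subset
    e' ⟨hxv.le.trans hve'.le, he't⟩ e ⟨hxv.le.trans hve.le, het⟩ <| by
      rw [he'_eq, Finset.insert_subset_iff, Finset.singleton_subset_iff]
      exact ⟨mem_intervalAtoms.2 ⟨hxv, hve.le⟩, mem_intervalAtoms.2 ⟨hxw, hwe⟩⟩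
  rwa [← hle.eq_of_not_lt (hve.2 hve'.lt)]

theorem exists_le_of_mem_atomClass (h : IsSemiBooleanInterval x y)
    (hg : grade ℕ x + 2 ≤ grade ℕ y) (hv : v ∈ intervalAtoms x y) (hw : w ∈ atomClass x y v) :
    ∃ e ∈ intervalAtoms v y, w ≤ e := by
  classical
  obtain ⟨hwy, z, hzy, hvz, hwz⟩ := mem_atomClass.1 hw
  obtain ⟨hxv, -⟩ := mem_intervalAtoms.1 hv
  obtain rfl | hvw := eq_or_ne v w
  · obtain ⟨e, he⟩ := intervalAtoms_nonempty (lt_of_mem_intervalAtoms hg hv)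
    exact ⟨e, he, (mem_intervalAtoms.1 he).1.le⟩
  · obtain ⟨e, he, he_eq⟩ := (h.lower z ⟨hxv.le.trans hvz, hzy⟩).exists_intervalAtoms_eq_pair
      (mem_intervalAtoms.2 ⟨hxv, hvz⟩)
      (mem_intervalAtoms.2 ⟨(mem_intervalAtoms.1 hwy).1, hwz⟩) hvw
    exact ⟨e, intervalAtoms_mono hzy.le he, (mem_intervalAtoms.1
      (he_eq ▸ by simp : w ∈ intervalAtoms x e)).2⟩

theorem atomClass_subset_atomClass (h : IsSemiBooleanInterval x y)
    (hg : grade ℕ x + 4 ≤ grade ℕ y) (hv : v ∈ intervalAtoms x y) (hw : w ∈ atomClass x y v) :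
    atomClass x y v ⊆ atomClass x y w := by
  intro u hu
  obtain ⟨e, he, hwe⟩ := h.exists_le_of_mem_atomClass (by omega) hv hw
  obtain ⟨e', he', hue'⟩ := h.exists_le_of_mem_atomClass (by omega) hv hu
  obtain ⟨t, hty, het, he't⟩ := h.exists_lt_of_mem_intervalAtoms hg hv he he'
  exact mem_atomClass.2 ⟨atomClass_subset hu, t, hty, hwe.trans het, hue'.trans he't⟩

theorem atomClass_eq_iff (h : IsSemiBooleanInterval x y) (hg : grade ℕ x + 4 ≤ grade ℕ y)
    (hv : v ∈ intervalAtoms x y) (hw : w ∈ intervalAtoms x y) :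
    atomClass x y v = atomClass x y w ↔ w ∈ atomClass x y v := by
  refine ⟨fun heq => heq ▸ mem_atomClass_self (by omega) hw, fun hmem => ?_⟩
  exact (h.atomClass_subset_atomClass hg hv hmem).antisymm
    (h.atomClass_subset_atomClass hg hw ((mem_atomClass_comm hv hw).2 hmem))

theorem card_atomClass_add_grade (h : IsSemiBooleanInterval x y)
    (hg : grade ℕ x + 4 ≤ grade ℕ y) (hv : v ∈ intervalAtoms x y) :
    (atomClass x y v).card + grade ℕ x = grade ℕ y := by
  classical
  choose! w hw_atom hw_ne hw_eq using
    fun e (he : e ∈ intervalAtoms v y) => h.exists_intervalAtoms_eq_pair (by omega) hv he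
  have hw_le : ∀ e ∈ intervalAtoms v y, w e ≤ e := fun e he =>
    (mem_intervalAtoms.1 (hw_eq e he ▸ by simp : w e ∈ intervalAtoms x e)).2
  have hcard : (intervalAtoms v y).card = ((atomClass x y v).erase v).card := by
    refine Finset.card_nbij w (fun e he => ?_) (fun e he e' he' hee' => ?_) fun u hu => ?_
    · refine Finset.mem_erase.2 ⟨(hw_ne e he).symm, mem_atomClass.2 ⟨hw_atom e he, e, ?_, ?_⟩⟩
      · exact lt_of_mem_intervalAtoms_of_mem (by omega) hv he
      · exact ⟨(mem_intervalAtoms.1 he).1.le, hw_le e he⟩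
    · obtain ⟨hve, hey⟩ := mem_intervalAtoms.1 he
      have hve' := (mem_intervalAtoms.1 he').1
      have hle := (h.le_iff_le_of_mem_intervalAtoms hg hv (hw_atom e' he') (hw_ne e' he') he'
        (hw_le e' he') ⟨hve.le, hey⟩).1 (hee' ▸ hw_le e he)
      exact (hle.eq_of_not_lt (hve.2 hve'.lt)).symm
    · obtain ⟨huv, hu⟩ := Finset.mem_erase.1 hu
      obtain ⟨e, he, hue⟩ := h.exists_le_of_mem_atomClass (by omega) hv hu
      have hu_e : u ∈ intervalAtoms x e :=
        mem_intervalAtoms.2 ⟨(mem_intervalAtoms.1 (atomClass_subset hu)).1, hue⟩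
      rw [hw_eq e he, Finset.mem_insert, Finset.mem_singleton] at hu_e
      exact ⟨e, he, (hu_e.resolve_left huv).symm⟩
  obtain ⟨hxv, hvy⟩ := mem_intervalAtoms.1 hv
  have hgv := grade_eq_add_one_of_covBy hxv
  have hcard' := (h.upper v ⟨hxv.lt, hvy⟩).card_intervalAtoms_add_grade
  rw [← Finset.card_erase_add_one (mem_atomClass_self (by omega) hv)]
  omega

theorem intervalAtoms_ssubset_atomClass (h : IsSemiBooleanInterval x y)
    (hg : grade ℕ x + 4 ≤ grade ℕ y) (hv : v ∈ intervalAtoms x y) (hz : z ∈ Set.Ico v y) :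
    intervalAtoms x z ⊂ atomClass x y v := by
  refine (intervalAtoms_subset_atomClass hz.2 hz.1).ssubset_of_ne fun heq => ?_
  have hxv := (mem_intervalAtoms.1 hv).1
  have hcard := (h.lower z ⟨hxv.le.trans hz.1, hz.2⟩).card_intervalAtoms_add_grade
  rw [heq, h.card_atomClass_add_grade hg hv] at hcard
  exact (grade_strictMono hz.2).ne' hcard

theorem le_of_intervalAtoms_subset (h : IsSemiBooleanInterval x y)
    (hg : grade ℕ x + 4 ≤ grade ℕ y) (hz : z ∈ Set.Ico x y) (hw : w ∈ Set.Ico x y)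
    (hs : intervalAtoms x z ⊆ intervalAtoms x w) : z ≤ w := by
  classical
  obtain rfl | hxz := hz.1.eq_or_lt
  · exact hw.1
  obtain ⟨v, hv⟩ := intervalAtoms_nonempty hxz
  obtain ⟨hxv, hvz⟩ := mem_intervalAtoms.1 hv
  have hvw := (mem_intervalAtoms.1 (hs hv)).2
  refine (h.upper v ⟨hxv.lt, hvz.trans hz.2.le⟩).le_of_intervalAtoms_subset z ⟨hvz, hz.2.le⟩ w
    ⟨hvw, hw.2.le⟩ fun e he => ?_
  have hv_y := intervalAtoms_mono hz.2.le hv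
  have he_y := intervalAtoms_mono hz.2.le he
  obtain ⟨hve, hez⟩ := mem_intervalAtoms.1 he
  obtain ⟨u, hu, hvu, he_eq⟩ := h.exists_intervalAtoms_eq_pair (by omega) hv_y he_y
  have hu_e : u ∈ intervalAtoms x e := he_eq ▸ by simp
  have huw := (mem_intervalAtoms.1 (hs (intervalAtoms_mono hez hu_e))).2
  exact mem_intervalAtoms.2 ⟨hve, (h.le_iff_le_of_mem_intervalAtoms hg hv_y hu hvu he_y
    (mem_intervalAtoms.1 hu_e).2 ⟨hvw, hw.2.le⟩).1 huw⟩

theorem exists_forall_le_iff_mem (h : IsSemiBooleanInterval x y)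
    (hg : grade ℕ x + 4 ≤ grade ℕ y) (hv : v ∈ intervalAtoms x y) {T : Finset P} (hvT : v ∈ T)
    (hT : T ⊆ atomClass x y v) :
    ∃ z ∈ Set.Icc v y, ∀ u ∈ atomClass x y v, u ≤ z ↔ u ∈ T := by
  classical
  obtain ⟨hxv, hvy⟩ := mem_intervalAtoms.1 hv
  obtain ⟨z, hz, hz_eq⟩ := (h.upper v ⟨hxv.lt, hvy⟩).exists_intervalAtoms_eq
    {e ∈ intervalAtoms v y | ∃ u ∈ T, v ≠ u ∧ u ≤ e} (Finset.filter_subset _ _)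
  refine ⟨z, hz, fun u hu => ?_⟩
  obtain rfl | hvu := eq_or_ne v u
  · exact iff_of_true hz.1 hvT
  obtain ⟨e, he, hue⟩ := h.exists_le_of_mem_atomClass (by omega) hv hu
  have hez : e ≤ z ↔ e ∈ intervalAtoms v z := by
    rw [mem_intervalAtoms, and_iff_right (mem_intervalAtoms.1 he).1]
  rw [h.le_iff_le_of_mem_intervalAtoms hg hv (atomClass_subset hu) hvu he hue hz, hez, hz_eq,
    Finset.mem_filter, and_iff_right he]
  refine ⟨?_, fun huT => ⟨u, huT, hvu, hue⟩⟩
  rintro ⟨u', hu'T, hvu', hu'e⟩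
  obtain ⟨w, -, -, he_eq⟩ := h.exists_intervalAtoms_eq_pair (by omega) hv he
  have eq_of_le : ∀ a ∈ atomClass x y v, v ≠ a → a ≤ e → a = w := fun a ha hva hae => by
    have ha_e : a ∈ intervalAtoms x e :=
      mem_intervalAtoms.2 ⟨(mem_intervalAtoms.1 (atomClass_subset ha)).1, hae⟩
    rw [he_eq, Finset.mem_insert, Finset.mem_singleton] at ha_e
    exact ha_e.resolve_left hva.symm
  rwa [eq_of_le u hu hvu hue, ← eq_of_le u' (hT hu'T) hvu' hu'e]

theorem exists_intervalAtoms_eq (h : IsSemiBooleanInterval x y)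
    (hg : grade ℕ x + 4 ≤ grade ℕ y) (hv : v ∈ intervalAtoms x y) {T : Finset P} (hvT : v ∈ T)
    (hT : T ⊂ atomClass x y v) : ∃ z ∈ Set.Ico v y, intervalAtoms x z = T := by
  obtain ⟨z, hz, hz_iff⟩ := h.exists_forall_le_iff_mem hg hv hvT hT.subset
  have hzy : z < y := hz.2.lt_of_ne <| by
    rintro rfl
    exact hT.not_subset fun u hu =>
      (hz_iff u hu).1 (mem_intervalAtoms.1 (atomClass_subset hu)).2
  refine ⟨z, ⟨hz.1, hzy⟩, Finset.Subset.antisymm (fun u hu => ?_) fun u hu => ?_⟩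
  · exact (hz_iff u (intervalAtoms_subset_atomClass hzy hz.1 hu)).1 (mem_intervalAtoms.1 hu).2
  · exact mem_intervalAtoms.2 ⟨(mem_intervalAtoms.1 (atomClass_subset (hT.subset hu))).1,
      (hz_iff u (hT.subset hu)).2 hu⟩

theorem isBooleanInterval (h : IsSemiBooleanInterval x y) (hg : grade ℕ x + 4 ≤ grade ℕ y)
    (hxy : x ≤ y) (hclass : ∀ v ∈ intervalAtoms x y, atomClass x y v = intervalAtoms x y) :
    IsBooleanInterval x y := by
  have ssubset : ∀ z ∈ Set.Ico x y, intervalAtoms x z ⊂ intervalAtoms x y := fun z hz => by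
    obtain rfl | hxz := hz.1.eq_or_lt
    · rw [intervalAtoms_self]
      exact (intervalAtoms_nonempty hz.2).empty_ssubset
    obtain ⟨v, hv⟩ := intervalAtoms_nonempty hxz
    have hv_y := intervalAtoms_mono hz.2.le hv
    rw [← hclass v hv_y]
    exact h.intervalAtoms_ssubset_atomClass hg hv_y ⟨(mem_intervalAtoms.1 hv).2, hz.2⟩
  refine ⟨fun z hz w hw hs => ?_, fun T hT => ?_⟩
  · obtain rfl | hwy := hw.2.eq_or_lt
    · exact hz.2
    obtain rfl | hzy := hz.2.eq_or_lt
    · exact absurd hs (ssubset w ⟨hw.1, hwy⟩).not_subset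
    exact h.le_of_intervalAtoms_subset hg ⟨hz.1, hzy⟩ ⟨hw.1, hwy⟩ hs
  · obtain rfl | ⟨v, hvT⟩ := T.eq_empty_or_nonempty
    · exact ⟨x, ⟨le_rfl, hxy⟩, intervalAtoms_self x⟩
    obtain rfl | hT := hT.eq_or_ssubset
    · exact ⟨y, ⟨hxy, le_rfl⟩, rfl⟩
    have hv := hT.subset hvT
    obtain ⟨z, hz, hz_eq⟩ := h.exists_intervalAtoms_eq hg hv hvT (hclass v hv ▸ hT)
    exact ⟨z, ⟨(mem_intervalAtoms.1 hv).1.le.trans hz.1, hz.2.le⟩, hz_eq⟩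

theorem isBooleanInterval_or_le_card (h : IsSemiBooleanInterval x y) {r : ℕ} (hr : 4 ≤ r)
    (hxy : x ≤ y) (hg : grade ℕ y = grade ℕ x + r) :
    IsBooleanInterval x y ∨ 2 * r ≤ (intervalAtoms x y).card := by
  classical
  have hg' : grade ℕ x + 4 ≤ grade ℕ y := by omega
  rw [or_iff_not_imp_left]
  intro hB
  obtain ⟨v, hv, hne⟩ : ∃ v ∈ intervalAtoms x y, atomClass x y v ≠ intervalAtoms x y := by
    by_contra! hclass
    exact hB (h.isBooleanInterval hg' hxy hclass)
  obtain ⟨w, hw, hwv⟩ := Finset.exists_of_ssubset (atomClass_subset.ssubset_of_ne hne)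
  have hdisj : Disjoint (atomClass x y v) (atomClass x y w) := by
    refine Finset.disjoint_left.2 fun u huv huw => hwv ?_
    have hu := atomClass_subset huv
    rw [← h.atomClass_eq_iff hg' hv hw, (h.atomClass_eq_iff hg' hv hu).2 huv,
      (h.atomClass_eq_iff hg' hw hu).2 huw]
  have hcard := Finset.card_le_card (Finset.union_subset (atomClass_subset (v := v))
    (atomClass_subset (x := x) (y := y) (v := w)))
  have hcard_v := h.card_atomClass_add_grade hg' hv
  have hcard_w := h.card_atomClass_add_grade hg' hw
  rw [Finset.card_union_of_disjoint hdisj] at hcard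
  omega

end IsSemiBooleanInterval

end SemiBooleanIntervals

section MaximalChains

theorem numMaxChains_pos {P : Type*} [PartialOrder P] [Finite P] (x y : P) :
    0 < numMaxChains x y :=
  Nat.card_pos

theorem numMaxChains_self {P : Type*} [PartialOrder P] (x : P) : numMaxChains x x = 1 := by
  refine Nat.card_eq_one_iff_unique.2 ⟨⟨fun s t => SetLike.ext fun a => ?_⟩, inferInstance⟩
  have mem (s : Flag (Set.Icc x x)) : a ∈ s :=
    Flag.mem_iff_forall_le_or_ge.2 fun b _ => Or.inl (a.2.2.trans b.2.1)
  exact iff_of_true (mem s) (mem t)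

variable {P : Type*} [PartialOrder P] [Fintype P] {x y a : P} {C : Finset P}

open Classical in
/-- The maximal chains of the interval `[x, y]`, as finite sets of elements of `P`. A subset of
`[x, y]` is a maximal chain if and only if its members are exactly the elements of `[x, y]` which
are comparable to all its members. -/
noncomputable def maxChains (x y : P) : Finset (Finset P) :=
  {C | ∀ u, u ∈ C ↔ u ∈ Set.Icc x y ∧ ∀ c ∈ C, u ≤ c ∨ c ≤ u}

theorem mem_maxChains :
    C ∈ maxChains x y ↔ ∀ u, u ∈ C ↔ u ∈ Set.Icc x y ∧ ∀ c ∈ C, u ≤ c ∨ c ≤ u := by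
  simp [maxChains]

theorem mem_Icc_of_mem_maxChains (hC : C ∈ maxChains x y) (ha : a ∈ C) : a ∈ Set.Icc x y :=
  ((mem_maxChains.1 hC a).1 ha).1

theorem left_mem_of_mem_maxChains (hxy : x ≤ y) (hC : C ∈ maxChains x y) : x ∈ C :=
  (mem_maxChains.1 hC x).2
    ⟨⟨le_rfl, hxy⟩, fun _ hc => Or.inl (mem_Icc_of_mem_maxChains hC hc).1⟩

theorem right_mem_of_mem_maxChains (hxy : x ≤ y) (hC : C ∈ maxChains x y) : y ∈ C :=
  (mem_maxChains.1 hC y).2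
    ⟨⟨hxy, le_rfl⟩, fun _ hc => Or.inr (mem_Icc_of_mem_maxChains hC hc).2⟩

open Classical in
theorem toFinset_image_flag_mem_maxChains (s : Flag (Set.Icc x y)) :
    ((↑) '' (s : Set (Set.Icc x y)) : Set P).toFinset ∈ maxChains x y := by
  rw [mem_maxChains]
  intro u
  simp only [Set.mem_toFinset, Set.mem_image]
  constructor
  · rintro ⟨u, hu, rfl⟩
    refine ⟨u.2, ?_⟩
    rintro _ ⟨c, hc, rfl⟩
    exact Flag.mem_iff_forall_le_or_ge.1 hu hc
  · rintro ⟨hu, hcomp⟩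
    exact ⟨⟨u, hu⟩, Flag.mem_iff_forall_le_or_ge.2 fun c hc => hcomp c ⟨c, hc, rfl⟩, rfl⟩

theorem isMaxChain_preimage_of_mem_maxChains (hC : C ∈ maxChains x y) :
    IsMaxChain (· ≤ ·) ((↑) ⁻¹' (C : Set P) : Set (Set.Icc x y)) := by
  rw [mem_maxChains] at hC
  refine ⟨fun c hc d hd _ => ((hC c).1 hc).2 d hd, fun t ht hCt => hCt.antisymm fun u hu => ?_⟩
  refine (hC u).2 ⟨u.2, fun c hc => ?_⟩
  exact ht.total hu (hCt (show (⟨c, ((hC c).1 hc).1⟩ : Set.Icc x y) ∈ _ from hc))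

theorem numMaxChains_eq_card_maxChains (x y : P) : numMaxChains x y = (maxChains x y).card := by
  classical
  let e : Flag (Set.Icc x y) ≃ maxChains x y :=
    { toFun := fun s => ⟨_, toFinset_image_flag_mem_maxChains s⟩
      invFun := fun C => .ofIsMaxChain _ (isMaxChain_preimage_of_mem_maxChains C.2)
      left_inv := fun s => Flag.ext <| by simp [Flag.coe_ofIsMaxChain, Set.preimage_image_eq]
      right_inv := fun C => Subtype.ext <| Finset.ext fun c => Set.mem_toFinset.trans <| by
        simpa [Flag.coe_ofIsMaxChain] using fun hc => mem_Icc_of_mem_maxChains C.2 hc }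
  rw [numMaxChains, Nat.card_congr e, Nat.card_eq_fintype_card, Fintype.card_coe]

theorem insert_mem_maxChains [DecidableEq P] (ha : a ∈ intervalAtoms x y)
    (hC : C ∈ maxChains a y) : insert x C ∈ maxChains x y := by
  obtain ⟨hxa, hay⟩ := mem_intervalAtoms.1 ha
  have ha_mem := left_mem_of_mem_maxChains hay hC
  have ha_le : ∀ c ∈ C, a ≤ c := fun c hc => (mem_Icc_of_mem_maxChains hC hc).1
  rw [mem_maxChains] at hC ⊢
  intro u
  rw [Finset.forall_mem_insert, Finset.mem_insert]
  constructor
  · rintro (rfl | hu)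
    · exact ⟨⟨le_rfl, hxa.le.trans hay⟩, Or.inl le_rfl,
        fun c hc => Or.inl (hxa.le.trans (ha_le c hc))⟩
    · obtain ⟨⟨hau, huy⟩, hcomp⟩ := (hC u).1 hu
      exact ⟨⟨hxa.le.trans hau, huy⟩, Or.inr (hxa.le.trans hau), hcomp⟩
  · rintro ⟨⟨hxu, huy⟩, -, hcomp⟩
    rw [or_iff_not_imp_left]
    intro hux
    refine (hC u).2 ⟨⟨?_, huy⟩, hcomp⟩
    rcases hcomp a ha_mem with hua | hau
    · exact (hua.eq_of_not_lt (hxa.2 (hxu.lt_of_ne' hux))).ge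
    · exact hau

theorem exists_erase_mem_maxChains [DecidableEq P] (hxy : x < y) (hC : C ∈ maxChains x y) :
    ∃ a ∈ intervalAtoms x y, C.erase x ∈ maxChains a y := by
  have hy := right_mem_of_mem_maxChains hxy.le hC
  have hxle : ∀ c ∈ C, x ≤ c := fun c hc => (mem_Icc_of_mem_maxChains hC hc).1
  rw [mem_maxChains] at hC
  obtain ⟨a, ha⟩ := (C.erase x).exists_minimal ⟨y, Finset.mem_erase.2 ⟨hxy.ne', hy⟩⟩
  obtain ⟨hax, haC⟩ := Finset.mem_erase.1 ha.prop
  have ha_le : ∀ c ∈ C.erase x, a ≤ c := fun c hc =>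
    (((hC a).1 haC).2 c (Finset.mem_of_mem_erase hc)).elim id (ha.le_of_le hc)
  have hcov : x ⋖ a := by
    refine ⟨(hxle a haC).lt_of_ne' hax, fun z hxz hza => hza.not_ge (ha_le z ?_)⟩
    refine Finset.mem_erase.2 ⟨hxz.ne', (hC z).2 ⟨⟨hxz.le, hza.le.trans ((hC a).1 haC).1.2⟩, ?_⟩⟩
    intro c hc
    obtain rfl | hcx := eq_or_ne c x
    · exact Or.inr hxz.le
    · exact Or.inl (hza.le.trans (ha_le c (Finset.mem_erase.2 ⟨hcx, hc⟩)))
  refine ⟨a, mem_intervalAtoms.2 ⟨hcov, ((hC a).1 haC).1.2⟩, mem_maxChains.2 fun u => ?_⟩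
  constructor
  · intro hu
    have hu' := (hC u).1 (Finset.mem_of_mem_erase hu)
    exact ⟨⟨ha_le u hu, hu'.1.2⟩, fun c hc => hu'.2 c (Finset.mem_of_mem_erase hc)⟩
  · rintro ⟨⟨hau, huy⟩, hcomp⟩
    have hxu := hcov.lt.trans_le hau
    refine Finset.mem_erase.2 ⟨hxu.ne', (hC u).2 ⟨⟨hxu.le, huy⟩, fun c hc => ?_⟩⟩
    obtain rfl | hcx := eq_or_ne c x
    · exact Or.inr hxu.le
    · exact hcomp c (Finset.mem_erase.2 ⟨hcx, hc⟩)

theorem numMaxChains_eq_sum (hxy : x < y) :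
    numMaxChains x y = ∑ a ∈ intervalAtoms x y, numMaxChains a y := by
  classical
  have notMem : ∀ {a C}, a ∈ intervalAtoms x y → C ∈ maxChains a y → x ∉ C := fun ha hC hx =>
    (mem_intervalAtoms.1 ha).1.lt.not_ge (mem_Icc_of_mem_maxChains hC hx).1
  have hdecomp : maxChains x y =
      (intervalAtoms x y).biUnion fun a => (maxChains a y).image (insert x) := by
    ext C
    simp only [Finset.mem_biUnion, Finset.mem_image]
    constructor
    · intro hC
      obtain ⟨a, ha, hCa⟩ := exists_erase_mem_maxChains hxy hC
      exact ⟨a, ha, _, hCa, Finset.insert_erase (left_mem_of_mem_maxChains hxy.le hC)⟩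
    · rintro ⟨a, ha, C, hC, rfl⟩
      exact insert_mem_maxChains ha hC
  have hdisj : (intervalAtoms x y : Set P).PairwiseDisjoint
      fun a => (maxChains a y).image (insert x) := by
    intro a ha b hb hab
    refine Finset.disjoint_left.2 fun C hCa hCb => hab ?_
    obtain ⟨D, hD, rfl⟩ := Finset.mem_image.1 hCa
    obtain ⟨E, hE, hDE⟩ := Finset.mem_image.1 hCb
    obtain rfl : E = D := by
      rw [← Finset.erase_insert (notMem hb hE), hDE, Finset.erase_insert (notMem ha hD)]
    have mem_of := fun {a} (ha : a ∈ intervalAtoms x y) (h : E ∈ maxChains a y) =>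
      left_mem_of_mem_maxChains (mem_intervalAtoms.1 ha).2 h
    exact (mem_Icc_of_mem_maxChains hD (mem_of hb hE)).1.antisymm
      (mem_Icc_of_mem_maxChains hE (mem_of ha hD)).1
  simp only [numMaxChains_eq_card_maxChains]
  rw [hdecomp, Finset.card_biUnion hdisj]
  refine Finset.sum_congr rfl fun a ha => Finset.card_image_of_injOn fun C hC D hD hCD => ?_
  rw [← Finset.erase_insert (notMem ha hC), hCD, Finset.erase_insert (notMem ha hD)]

theorem numMaxChains_of_covBy {P : Type*} [PartialOrder P] [Finite P] {x y : P} (h : x ⋖ y) :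
    numMaxChains x y = 1 := by
  have := Fintype.ofFinite P
  rw [numMaxChains_eq_sum h.lt, intervalAtoms_of_covBy h, Finset.sum_singleton, numMaxChains_self]

theorem IsTriangular.card_intervalAtoms_eq {P : Type*} [PartialOrder P] [Fintype P]
    [GradeMinOrder ℕ P] (hT : IsTriangular P) {x y u v : P} (hxy : x < y) (huv : u < v)
    (hxu : grade ℕ x = grade ℕ u) (hyv : grade ℕ y = grade ℕ v) :
    (intervalAtoms x y).card = (intervalAtoms u v).card := by
  obtain ⟨a, ha⟩ := intervalAtoms_nonempty hxy
  have numMaxChains_eq : ∀ {x' y' b : P}, grade ℕ x' = grade ℕ x → grade ℕ y' = grade ℕ y →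
      b ∈ intervalAtoms x' y' → numMaxChains b y' = numMaxChains a y := by
    intro x' y' b hx' hy' hb
    rw [mem_intervalAtoms] at ha hb
    refine hT _ _ _ _ hb.2 ha.2 ?_ hy'
    rw [grade_eq_add_one_of_covBy hb.1, grade_eq_add_one_of_covBy ha.1, hx']
  have hcount := hT x y u v hxy.le huv.le hxu hyv
  rw [numMaxChains_eq_sum hxy, numMaxChains_eq_sum huv,
    Finset.sum_const_nat fun b hb => numMaxChains_eq rfl rfl hb,
    Finset.sum_const_nat fun b hb => numMaxChains_eq hxu.symm hyv.symm hb] at hcount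
  exact Nat.eq_of_mul_eq_mul_right (numMaxChains_pos a y) hcount

end MaximalChains

section ThinPosets

variable {P : Type*} [PartialOrder P] [Fintype P] [GradeOrder ℕ P] {x y z w : P}

variable (P) in
/-- Every interval of rank two has exactly two atoms, that is, has the shape of a diamond. -/
def IsThin : Prop :=
  ∀ x y : P, x ≤ y → grade ℕ y = grade ℕ x + 2 → (intervalAtoms x y).card = 2

namespace IsThin

theorem numMaxChains_of_rank_two (hP : IsThin P) (hxy : x ≤ y)
    (hg : grade ℕ y = grade ℕ x + 2) : numMaxChains x y = 2 := by
  rw [numMaxChains_eq_sum (lt_of_le_of_grade_lt hxy (by omega)),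
    Finset.sum_congr rfl (g := fun _ => 1), Finset.sum_const, hP x y hxy hg, smul_eq_mul, mul_one]
  intro a ha
  obtain ⟨hxa, hay⟩ := mem_intervalAtoms.1 ha
  have hga := grade_eq_add_one_of_covBy hxa
  exact numMaxChains_of_covBy ((covBy_iff_grade_eq_add_one hay).2 (by omega))

theorem numMaxChains_of_rank_three (hP : IsThin P) (hxy : x ≤ y)
    (hg : grade ℕ y = grade ℕ x + 3) : numMaxChains x y = (intervalAtoms x y).card * 2 := by
  rw [numMaxChains_eq_sum (lt_of_le_of_grade_lt hxy (by omega))]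
  refine Finset.sum_const_nat fun a ha => ?_
  obtain ⟨hxa, hay⟩ := mem_intervalAtoms.1 ha
  have hga := grade_eq_add_one_of_covBy hxa
  exact hP.numMaxChains_of_rank_two hay (by omega)

theorem card_intervalAtoms_of_mem_intervalLevel_two (hP : IsThin P)
    (hz : z ∈ intervalLevel x y 2) : (intervalAtoms x z).card = 2 :=
  hP x z (mem_intervalLevel.1 hz).1.1 (mem_intervalLevel.1 hz).2

theorem card_intervalAtoms_of_mem_intervalAtoms (hP : IsThin P)
    (hg : grade ℕ y = grade ℕ x + 3) (hz : z ∈ intervalAtoms x y) :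
    (intervalAtoms z y).card = 2 := by
  obtain ⟨hxz, hzy⟩ := mem_intervalAtoms.1 hz
  have hgz := grade_eq_add_one_of_covBy hxz
  exact hP z y hzy (by omega)

theorem card_intervalLevel_two (hP : IsThin P) (hg : grade ℕ y = grade ℕ x + 3) :
    (intervalLevel x y 2).card = (intervalAtoms x y).card := by
  have hcount := sum_card_intervalLevel x y 1
  simp only [intervalLevel_one] at hcount
  rw [Finset.sum_const_nat fun v => hP.card_intervalAtoms_of_mem_intervalAtoms hg,
    Finset.sum_const_nat fun z => hP.card_intervalAtoms_of_mem_intervalLevel_two] at hcount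
  omega

/-- If two of the three coatoms had the same two atoms below them, then the third atom would lie
below the remaining coatom only. -/
theorem intervalAtoms_injOn (hP : IsThin P) (hg : grade ℕ y = grade ℕ x + 3)
    (hA : (intervalAtoms x y).card = 3) :
    Set.InjOn (intervalAtoms x) (intervalLevel x y 2 : Set P) := by
  classical
  intro z hz w hw hzw
  by_contra hne
  obtain ⟨a, ha, haz⟩ := Finset.exists_mem_notMem_of_card_lt_card
    (s := intervalAtoms x z) (t := intervalAtoms x y)
    (by rw [hA, hP.card_intervalAtoms_of_mem_intervalLevel_two hz]; norm_num)
  have haw : a ∉ intervalAtoms x w := hzw ▸ haz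
  obtain ⟨hxa, -⟩ := mem_intervalAtoms.1 ha
  have hga := grade_eq_add_one_of_covBy hxa
  have hsub : intervalAtoms a y ⊆ ((intervalLevel x y 2).erase z).erase w := by
    intro e he
    obtain ⟨hae, hey⟩ := mem_intervalAtoms.1 he
    have hge := grade_eq_add_one_of_covBy hae
    have ne_of : ∀ {u}, a ∉ intervalAtoms x u → e ≠ u := by
      rintro _ hau rfl
      exact hau (mem_intervalAtoms.2 ⟨hxa, hae.le⟩)
    exact Finset.mem_erase.2 ⟨ne_of haw, Finset.mem_erase.2 ⟨ne_of haz,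
      mem_intervalLevel.2 ⟨⟨hxa.le.trans hae.le, hey⟩, by omega⟩⟩⟩
  have hcard := Finset.card_le_card hsub
  rw [Finset.card_erase_of_mem (Finset.mem_erase.2 ⟨Ne.symm hne, hw⟩),
    Finset.card_erase_of_mem hz, hP.card_intervalLevel_two hg, hA,
    hP.card_intervalAtoms_of_mem_intervalAtoms hg ha] at hcard
  omega

theorem card_intervalAtoms_add_grade (hP : IsThin P) (hg : grade ℕ y = grade ℕ x + 3)
    (hA : (intervalAtoms x y).card = 3) (hz : z ∈ Set.Icc x y) :
    (intervalAtoms x z).card + grade ℕ x = grade ℕ z := by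
  have hgxz := grade_mono (𝕆 := ℕ) hz.1
  have hgzy := grade_mono (𝕆 := ℕ) hz.2
  obtain h₀ | h₁ | h₂ | h₃ : grade ℕ z = grade ℕ x ∨ grade ℕ z = grade ℕ x + 1 ∨
      grade ℕ z = grade ℕ x + 2 ∨ grade ℕ z = grade ℕ y := by omega
  · rw [← eq_of_le_of_grade_le hz.1 h₀.le, intervalAtoms_self, Finset.card_empty, zero_add]
  · rw [intervalAtoms_of_covBy ((covBy_iff_grade_eq_add_one hz.1).2 h₁), Finset.card_singleton,
      h₁, add_comm]
  · rw [hP x z hz.1 h₂, h₂, add_comm]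
  · rw [eq_of_le_of_grade_le hz.2 h₃.ge, hA, hg, add_comm]

theorem le_of_intervalAtoms_subset (hP : IsThin P) (hg : grade ℕ y = grade ℕ x + 3)
    (hA : (intervalAtoms x y).card = 3) (hz : z ∈ Set.Icc x y) (hw : w ∈ Set.Icc x y)
    (hs : intervalAtoms x z ⊆ intervalAtoms x w) : z ≤ w := by
  have hcard := Finset.card_le_card hs
  have hcard_z := hP.card_intervalAtoms_add_grade hg hA hz
  have hcard_w := hP.card_intervalAtoms_add_grade hg hA hw
  have hgxz := grade_mono (𝕆 := ℕ) hz.1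
  have hgwy := grade_mono (𝕆 := ℕ) hw.2
  obtain h₀ | h₁ | ⟨hz₂, hw₂⟩ | h₃ : grade ℕ z = grade ℕ x ∨ grade ℕ z = grade ℕ x + 1 ∨
      (grade ℕ z = grade ℕ x + 2 ∧ grade ℕ w = grade ℕ x + 2) ∨ grade ℕ w = grade ℕ y := by
    omega
  · exact (eq_of_le_of_grade_le hz.1 h₀.le).symm.trans_le hw.1
  · have hxz := (covBy_iff_grade_eq_add_one hz.1).2 h₁
    exact (mem_intervalAtoms.1 (hs (mem_intervalAtoms.2 ⟨hxz, le_rfl⟩))).2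
  · have heq := Finset.eq_of_subset_of_card_le hs (by omega)
    exact (hP.intervalAtoms_injOn hg hA (mem_intervalLevel.2 ⟨hz, hz₂⟩)
      (mem_intervalLevel.2 ⟨hw, hw₂⟩) heq).le
  · exact hz.2.trans_eq (eq_of_le_of_grade_le hw.2 h₃.ge).symm

theorem exists_intervalAtoms_eq (hP : IsThin P) (hxy : x ≤ y) (hg : grade ℕ y = grade ℕ x + 3)
    (hA : (intervalAtoms x y).card = 3) {T : Finset P} (hT : T ⊆ intervalAtoms x y) :
    ∃ z ∈ Set.Icc x y, intervalAtoms x z = T := by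
  have hcard := Finset.card_le_card hT
  rw [hA] at hcard
  obtain hT₀ | hT₁ | hT₂ | hT₃ : T.card = 0 ∨ T.card = 1 ∨ T.card = 2 ∨ T.card = 3 := by omega
  · exact ⟨x, ⟨le_rfl, hxy⟩, by rw [intervalAtoms_self, Finset.card_eq_zero.1 hT₀]⟩
  · obtain ⟨a, rfl⟩ := Finset.card_eq_one.1 hT₁
    obtain ⟨hxa, hay⟩ := mem_intervalAtoms.1 (Finset.singleton_subset_iff.1 hT)
    exact ⟨a, ⟨hxa.le, hay⟩, intervalAtoms_of_covBy hxa⟩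
  · have hmaps : Set.MapsTo (intervalAtoms x) (intervalLevel x y 2)
        ((intervalAtoms x y).powersetCard 2) := fun z hz => Finset.mem_powersetCard.2
      ⟨intervalAtoms_mono (mem_intervalLevel.1 hz).1.2,
        hP.card_intervalAtoms_of_mem_intervalLevel_two hz⟩
    obtain ⟨z, hz, rfl⟩ := Finset.surjOn_of_injOn_of_card_le _ hmaps
      (hP.intervalAtoms_injOn hg hA)
      (by rw [Finset.card_powersetCard, hP.card_intervalLevel_two hg, hA]; decide)
      (Finset.mem_powersetCard.2 ⟨hT, hT₂⟩)
    exact ⟨z, (mem_intervalLevel.1 hz).1, rfl⟩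
  · exact ⟨y, ⟨hxy, le_rfl⟩, (Finset.eq_of_subset_of_card_le hT (by rw [hA, hT₃])).symm⟩

theorem isBooleanInterval_of_rank_three (hP : IsThin P) (hxy : x ≤ y)
    (hg : grade ℕ y = grade ℕ x + 3) (hchains : numMaxChains x y = 6) :
    IsBooleanInterval x y := by
  have hA : (intervalAtoms x y).card = 3 := by
    have := hP.numMaxChains_of_rank_three hxy hg
    omega
  exact ⟨fun z hz w hw => hP.le_of_intervalAtoms_subset hg hA hz hw,
    fun T => hP.exists_intervalAtoms_eq hxy hg hA⟩

end IsThin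

end ThinPosets

section Eulerian

variable {P : Type*} [PartialOrder P] [Fintype P] {x y : P}

theorem sum_neg_one_pow_eq_card_even_sub_card_odd {α : Type*} (s : Finset α) (f : α → ℕ) :
    ∑ z ∈ s, (-1 : ℤ) ^ f z = {z ∈ s | Even (f z)}.card - {z ∈ s | Odd (f z)}.card := by
  have heven : ∀ z ∈ s.filter (Even ∘ f), (-1 : ℤ) ^ f z = 1 := fun z hz =>
    (Finset.mem_filter.1 hz).2.neg_one_pow
  have hodd : ∀ z ∈ s.filter (Odd ∘ f), (-1 : ℤ) ^ f z = -1 := fun z hz =>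
    (Finset.mem_filter.1 hz).2.neg_one_pow
  rw [← Finset.sum_filter_add_sum_filter_not s (Even ∘ f)]
  simp only [Function.comp_apply, Nat.not_even_iff_odd] at heven hodd ⊢
  rw [Finset.sum_congr rfl heven, Finset.sum_congr rfl hodd, Finset.sum_const, Finset.sum_const]
  simp only [nsmul_eq_mul, mul_one, mul_neg, sub_eq_add_neg]

open Classical in
theorem sum_neg_one_pow_grade_eq_sum_card_intervalLevel [GradeOrder ℕ P] {n : ℕ}
    (hn : grade ℕ y = grade ℕ x + n) :
    ∑ z ∈ (Set.Icc x y).toFinset, (-1 : ℤ) ^ grade ℕ z =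
      (-1) ^ grade ℕ x *
        ∑ k ∈ Finset.range (n + 1), (-1 : ℤ) ^ k * (intervalLevel x y k).card := by
  have hmaps : ∀ z ∈ (Set.Icc x y).toFinset, grade ℕ z - grade ℕ x ∈ Finset.range (n + 1) := by
    intro z hz
    have hgzy := grade_mono (𝕆 := ℕ) (Set.mem_toFinset.1 hz).2
    exact Finset.mem_range.2 (by omega)
  rw [← Finset.sum_fiberwise_of_maps_to hmaps, Finset.mul_sum]
  refine Finset.sum_congr rfl fun k _ => ?_
  have hlevel : {z ∈ (Set.Icc x y).toFinset | grade ℕ z - grade ℕ x = k} = intervalLevel x y k := by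
    ext z
    rw [Finset.mem_filter, Set.mem_toFinset, mem_intervalLevel]
    refine and_congr_right fun hz => ?_
    have hgxz := grade_mono (𝕆 := ℕ) hz.1
    omega
  have hsign : ∀ z ∈ intervalLevel x y k, (-1 : ℤ) ^ grade ℕ z = (-1) ^ grade ℕ x * (-1) ^ k :=
    fun z hz => by rw [(mem_intervalLevel.1 hz).2, pow_add]
  rw [hlevel, Finset.sum_congr rfl hsign, Finset.sum_const, nsmul_eq_mul]
  ring

variable [GradeMinOrder ℕ P]

theorem IsEulerian.sum_neg_one_pow_mul_card_intervalLevel_eq_zero (hE : IsEulerian P)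
    (hxy : x < y) {n : ℕ} (hn : grade ℕ y = grade ℕ x + n) :
    ∑ k ∈ Finset.range (n + 1), (-1 : ℤ) ^ k * (intervalLevel x y k).card = 0 := by
  classical
  have hsum := sum_neg_one_pow_grade_eq_sum_card_intervalLevel hn
  have hbalance := hE x y hxy
  have ncard_eq (p : P → Prop) [DecidablePred p] :
      {z ∈ Set.Icc x y | p z}.ncard = {z ∈ (Set.Icc x y).toFinset | p z}.card := by
    rw [← Set.ncard_coe_finset, Finset.coe_filter]
    simp only [Set.mem_toFinset]
  rw [ncard_eq, ncard_eq] at hbalance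
  rw [sum_neg_one_pow_eq_card_even_sub_card_odd, hbalance, sub_self, eq_comm, mul_eq_zero] at hsum
  exact hsum.resolve_left (pow_ne_zero _ (by norm_num))

theorem IsEulerian.isThin (hE : IsEulerian P) : IsThin P := by
  intro x y hxy hg
  have hsum := hE.sum_neg_one_pow_mul_card_intervalLevel_eq_zero
    (lt_of_le_of_grade_lt hxy (by omega)) hg
  simp only [Finset.sum_range_succ, Finset.sum_range_zero, intervalLevel_zero hxy,
    intervalLevel_one, intervalLevel_top hxy hg, Finset.card_singleton] at hsum
  norm_num at hsum
  omega

end Eulerian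

section EvenRank

variable {P : Type*} [PartialOrder P] [Fintype P]

section Counting

variable [GradeOrder ℕ P] {x y : P} {p q r m k : ℕ}

theorem mul_sum_card_intervalAtoms (hg : grade ℕ y = grade ℕ x + (r + 2))
    (hupper : ∀ v ∈ intervalAtoms x y, IsSemiBooleanInterval v y)
    (hp : ∀ v ∈ intervalAtoms x y, (intervalAtoms v y).card = p) (hk : k < r) :
    (k + 1) * ∑ z ∈ intervalLevel x y (k + 2), (intervalAtoms x z).card =
      (intervalAtoms x y).card * (p * r.choose k) := by
  rw [← sum_card_intervalLevel x y (k + 1), Finset.mul_sum]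
  refine Finset.sum_const_nat fun v hv => ?_
  have hgv := grade_eq_add_one_of_covBy (mem_intervalAtoms.1 hv).1
  rw [(hupper v hv).card_intervalLevel_succ (r := r) (by omega) hk, hp v hv]

theorem card_intervalAtoms_mul_eq_card_coatoms_mul (hg : grade ℕ y = grade ℕ x + (r + 3))
    (hupper : ∀ v ∈ intervalAtoms x y, IsSemiBooleanInterval v y)
    (hp : ∀ v ∈ intervalAtoms x y, (intervalAtoms v y).card = p)
    (hq : ∀ w ∈ intervalLevel x y (r + 2), (intervalAtoms x w).card = q) :
    (intervalAtoms x y).card * p = (intervalLevel x y (r + 2)).card * q := by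
  have hcount := mul_sum_card_intervalAtoms (r := r + 1) hg hupper hp r.lt_add_one
  rw [Finset.sum_const_nat hq, Nat.choose_succ_self_right] at hcount
  exact (Nat.eq_of_mul_eq_mul_right (show 0 < r + 1 by omega) (by linear_combination hcount)).symm

theorem mul_card_intervalLevel_eq_mul_choose (hg : grade ℕ y = grade ℕ x + (r + 2))
    (hupper : ∀ v ∈ intervalAtoms x y, IsSemiBooleanInterval v y)
    (hp : ∀ v ∈ intervalAtoms x y, (intervalAtoms v y).card = p)
    (hlower : ∀ z ∈ intervalLevel x y (k + 2), IsBooleanInterval x z) (hk : k < r) :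
    (r + 2) * (r + 1) * (intervalLevel x y (k + 2)).card =
      (intervalAtoms x y).card * p * (r + 2).choose (k + 2) := by
  have hcard : ∀ z ∈ intervalLevel x y (k + 2), (intervalAtoms x z).card = k + 2 := fun z hz => by
    have := (hlower z hz).card_intervalAtoms_add_grade
    have := (mem_intervalLevel.1 hz).2
    omega
  have hcount := mul_sum_card_intervalAtoms hg hupper hp hk
  rw [Finset.sum_const_nat hcard] at hcount
  have hchoose := Nat.add_one_mul_choose_eq r k
  have hchoose' := Nat.add_one_mul_choose_eq (r + 1) (k + 1)
  refine Nat.eq_of_mul_eq_mul_right (show 0 < (k + 1) * (k + 2) by positivity) ?_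
  zify at hcount hchoose hchoose' ⊢
  linear_combination (r + 2) * (r + 1) * hcount +
    (intervalAtoms x y).card * p * ((r + 2) * hchoose + (k + 1) * hchoose')

end Counting

theorem mul_add_lt_of_le_of_mul_eq_mul {m a c p q : ℕ} (hp : 2 * (m + 3) ≤ p) (hq : m + 3 ≤ q)
    (hac : a * p = c * q) : (m + 4) * (a + c) < 2 * (m + 4) + 2 * (a * p) := by
  have ha : 2 * (m + 3) * a ≤ a * p := by rw [mul_comm a]; gcongr
  have hc : (m + 3) * c ≤ a * p := by rw [hac, mul_comm c]; gcongr
  nlinarith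

theorem eq_of_mul_add_eq {m a c p q : ℕ} (hp : p = m + 3 ∨ 2 * (m + 3) ≤ p)
    (hq : q = m + 3 ∨ 2 * (m + 3) ≤ q) (hac : a * p = c * q)
    (h : (m + 4) * (a + c) = 2 * (m + 4) + 2 * (a * p)) :
    p = m + 3 ∧ q = m + 3 ∧ a = m + 4 := by
  have hp_eq : p = m + 3 := hp.resolve_right fun hp' =>
    (mul_add_lt_of_le_of_mul_eq_mul hp' (by omega) hac).ne h
  have hq_eq : q = m + 3 := hq.resolve_right fun hq' => by
    have hlt := mul_add_lt_of_le_of_mul_eq_mul hq' (by omega) hac.symm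
    rw [add_comm c, ← hac] at hlt
    exact hlt.ne h
  subst hp_eq hq_eq
  obtain rfl : a = c := Nat.eq_of_mul_eq_mul_right (by omega) hac
  exact ⟨rfl, rfl, by linarith⟩

variable [GradeMinOrder ℕ P] {x y : P} {m : ℕ}

/-- The numbers of elements of the levels are proportional to binomial coefficients except for the
bounds, the atoms and the coatoms, so that subtracting the Euler relation of the boolean lattice
leaves only the latter. -/
theorem IsEulerian.mul_card_intervalAtoms_add_card_coatoms (hE : IsEulerian P) (hm : Even m)
    (hxy : x < y) (hg : grade ℕ y = grade ℕ x + (m + 4)) {b : ℕ}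
    (hlevel : ∀ k ≤ m, (m + 4) * (m + 3) * (intervalLevel x y (k + 2)).card =
      b * (m + 4).choose (k + 2)) :
    (m + 4) * ((intervalAtoms x y).card + (intervalLevel x y (m + 3)).card) =
      2 * (m + 4) + 2 * b := by
  have heuler := hE.sum_neg_one_pow_mul_card_intervalLevel_eq_zero hxy hg
  have hbinom := Int.alternating_sum_range_choose_of_ne (n := m + 4) (by omega)
  rw [Finset.sum_range_succ, Finset.sum_range_succ, Finset.sum_range_succ',
    Finset.sum_range_succ'] at heuler hbinom
  have hmiddle : (∑ k ∈ Finset.range (m + 1), (-1 : ℤ) ^ (k + 1 + 1) *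
        (intervalLevel x y (k + 1 + 1)).card) * ((m + 4) * (m + 3)) =
      (∑ k ∈ Finset.range (m + 1), (-1 : ℤ) ^ (k + 1 + 1) * (m + 4).choose (k + 1 + 1)) * b := by
    rw [Finset.sum_mul, Finset.sum_mul]
    refine Finset.sum_congr rfl fun k hk => ?_
    have hk_level := hlevel k (Nat.lt_succ_iff.1 (Finset.mem_range.1 hk))
    zify at hk_level
    linear_combination (-1 : ℤ) ^ (k + 2) * hk_level
  have hodd : (-1 : ℤ) ^ (m + 3) = -1 := (hm.add_odd (by decide)).neg_one_pow
  have heven : (-1 : ℤ) ^ (m + 4) = 1 := (hm.add (by decide)).neg_one_pow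
  have hchoose : (m + 4).choose (m + 3) = m + 4 := Nat.choose_succ_self_right (m + 3)
  simp only [intervalLevel_zero hxy.le, intervalLevel_one, intervalLevel_top hxy.le hg,
    Finset.card_singleton, zero_add, Nat.choose_self, Nat.choose_zero_right, Nat.choose_one_right,
    hchoose, hodd, heven] at heuler hbinom
  push_cast at heuler hbinom
  refine Nat.eq_of_mul_eq_mul_right (show 0 < m + 3 by omega) ?_
  zify
  linear_combination -(m + 4) * (m + 3) * heuler + b * hbinom + hmiddle

variable (P) in
/-- All intervals of rank `r` are semi-boolean, and those which are not boolean have at least twice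
as many atoms as boolean ones. In rank three a semi-boolean interval is a disjoint union of polygons
between its bounds; there the condition on atoms excludes, for instance, a single octagon. -/
def HasSemiBooleanIntervals (r : ℕ) : Prop :=
  ∀ x y : P, x ≤ y → grade ℕ y = grade ℕ x + r →
    IsSemiBooleanInterval x y ∧ (IsBooleanInterval x y ∨ 2 * r ≤ (intervalAtoms x y).card)

theorem hasSemiBooleanIntervals_of_isBooleanInterval {r : ℕ}
    (hB : ∀ x y : P, x ≤ y → grade ℕ y = grade ℕ x + r → IsBooleanInterval x y) :
    HasSemiBooleanIntervals P r := fun x y hxy hg =>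
  ⟨(hB x y hxy hg).isSemiBooleanInterval, Or.inl (hB x y hxy hg)⟩

theorem hasSemiBooleanIntervals_succ_of_isBooleanInterval {r : ℕ} (hr : 3 ≤ r)
    (hB : ∀ x y : P, x ≤ y → grade ℕ y = grade ℕ x + r → IsBooleanInterval x y) :
    HasSemiBooleanIntervals P (r + 1) := by
  intro x y hxy hg
  have hsemi : IsSemiBooleanInterval x y := isSemiBooleanInterval_of_covBy
    (fun v hxv hvy => hB v y hvy (by have := grade_eq_add_one_of_covBy hxv; omega))
    (fun w hxw hwy => hB x w hxw (by have := grade_eq_add_one_of_covBy hwy; omega))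
  exact ⟨hsemi, hsemi.isBooleanInterval_or_le_card (by omega) hxy hg⟩

namespace HasSemiBooleanIntervals

theorem isBooleanInterval (h : HasSemiBooleanIntervals P m) (hxy : x ≤ y)
    (hg : grade ℕ y = grade ℕ x + m) (hcard : (intervalAtoms x y).card < 2 * m) :
    IsBooleanInterval x y :=
  (h x y hxy hg).2.resolve_right hcard.not_ge

theorem card_intervalAtoms_eq_or_le (h : HasSemiBooleanIntervals P m) (hxy : x ≤ y)
    (hg : grade ℕ y = grade ℕ x + m) :
    (intervalAtoms x y).card = m ∨ 2 * m ≤ (intervalAtoms x y).card :=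
  (h x y hxy hg).2.imp_left fun hB => by
    have := hB.card_intervalAtoms_add_grade
    omega

theorem isBooleanInterval_of_mem_intervalLevel (h : HasSemiBooleanIntervals P m)
    (hg : grade ℕ y = grade ℕ x + (m + 1)) {k : ℕ} (hk : k < m) {z : P}
    (hz : z ∈ intervalLevel x y k) : IsBooleanInterval x z := by
  obtain ⟨⟨hxz, hzy⟩, hgz⟩ := mem_intervalLevel.1 hz
  obtain ⟨w, hzw, hwy⟩ := exists_le_covBy_of_lt (lt_of_le_of_grade_lt hzy (by omega))
  have hgw := grade_eq_add_one_of_covBy hwy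
  exact (h x w (hxz.trans hzw) (by omega)).1.lower z
    ⟨hxz, lt_of_le_of_grade_lt hzw (by omega)⟩

end HasSemiBooleanIntervals

theorem IsEulerian.card_intervalAtoms_eq (hE : IsEulerian P)
    (hP : HasSemiBooleanIntervals P (m + 3)) (hm : Even m) (hxy : x < y)
    (hg : grade ℕ y = grade ℕ x + (m + 4)) {p q : ℕ}
    (hp : ∀ v ∈ intervalAtoms x y, (intervalAtoms v y).card = p)
    (hq : ∀ w ∈ intervalLevel x y (m + 3), (intervalAtoms x w).card = q) :
    p = m + 3 ∧ q = m + 3 ∧ (intervalAtoms x y).card = m + 4 := by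
  have hatom : ∀ v ∈ intervalAtoms x y, v ≤ y ∧ grade ℕ y = grade ℕ v + (m + 3) := fun v hv => by
    obtain ⟨hxv, hvy⟩ := mem_intervalAtoms.1 hv
    have hgv := grade_eq_add_one_of_covBy hxv
    exact ⟨hvy, by omega⟩
  have hupper : ∀ v ∈ intervalAtoms x y, IsSemiBooleanInterval v y := fun v hv =>
    (hP v y (hatom v hv).1 (hatom v hv).2).1
  have hp_or : p = m + 3 ∨ 2 * (m + 3) ≤ p := by
    obtain ⟨v, hv⟩ := intervalAtoms_nonempty hxy
    exact hp v hv ▸ hP.card_intervalAtoms_eq_or_le (hatom v hv).1 (hatom v hv).2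
  have hq_or : q = m + 3 ∨ 2 * (m + 3) ≤ q := by
    obtain ⟨w, hxw, hwy⟩ := exists_le_covBy_of_lt hxy
    have hgw := grade_eq_add_one_of_covBy hwy
    have hw : w ∈ intervalLevel x y (m + 3) := mem_intervalLevel.2 ⟨⟨hxw, hwy.le⟩, by omega⟩
    exact hq w hw ▸ hP.card_intervalAtoms_eq_or_le hxw (by omega)
  refine eq_of_mul_add_eq hp_or hq_or
    (card_intervalAtoms_mul_eq_card_coatoms_mul (r := m + 1) hg hupper hp hq)
    (hE.mul_card_intervalAtoms_add_card_coatoms hm hxy hg fun k hk => ?_)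
  exact mul_card_intervalLevel_eq_mul_choose (r := m + 2) hg hupper hp
    (fun z hz => hP.isBooleanInterval_of_mem_intervalLevel hg (by omega) hz) (by omega)

theorem IsEulerian.isBooleanInterval_of_even (hE : IsEulerian P) (hT : IsTriangular P)
    (hP : HasSemiBooleanIntervals P (m + 3)) (hm : Even m) (hxy : x ≤ y)
    (hg : grade ℕ y = grade ℕ x + (m + 4)) : IsBooleanInterval x y := by
  have hlt : x < y := lt_of_le_of_grade_lt hxy (by omega)
  obtain ⟨v₀, hxv₀, hv₀y⟩ := exists_covBy_le_of_lt hlt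
  obtain ⟨w₀, hxw₀, hw₀y⟩ := exists_le_covBy_of_lt hlt
  have hgv₀ := grade_eq_add_one_of_covBy hxv₀
  have hgw₀ := grade_eq_add_one_of_covBy hw₀y
  have hp : ∀ v, v ≤ y → grade ℕ v = grade ℕ x + 1 →
      (intervalAtoms v y).card = (intervalAtoms v₀ y).card := fun v hvy hgv =>
    hT.card_intervalAtoms_eq (lt_of_le_of_grade_lt hvy (by omega))
      (lt_of_le_of_grade_lt hv₀y (by omega)) (by omega) rfl
  have hq : ∀ w, x ≤ w → grade ℕ w = grade ℕ x + (m + 3) →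
      (intervalAtoms x w).card = (intervalAtoms x w₀).card := fun w hxw hgw =>
    hT.card_intervalAtoms_eq (lt_of_le_of_grade_lt hxw (by omega))
      (lt_of_le_of_grade_lt hxw₀ (by omega)) rfl (by omega)
  obtain ⟨hp_eq, hq_eq, ha_eq⟩ := hE.card_intervalAtoms_eq hP hm hlt hg
    (fun v hv => hp v (mem_intervalAtoms.1 hv).2
      (grade_eq_add_one_of_covBy (mem_intervalAtoms.1 hv).1))
    (fun w hw => hq w (mem_intervalLevel.1 hw).1.1 (mem_intervalLevel.1 hw).2)
  have hsemi : IsSemiBooleanInterval x y := isSemiBooleanInterval_of_covBy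
    (fun v hxv hvy => by
      have hgv := grade_eq_add_one_of_covBy hxv
      exact hP.isBooleanInterval hvy (by omega) (by rw [hp v hvy hgv]; omega))
    (fun w hxw hwy => by
      have hgw := grade_eq_add_one_of_covBy hwy
      exact hP.isBooleanInterval hxw (by omega) (by rw [hq w hxw (by omega)]; omega))
  exact (hsemi.isBooleanInterval_or_le_card (by omega) hxy hg).resolve_right (by omega)

theorem IsEulerian.hasSemiBooleanIntervals_odd (hE : IsEulerian P) (hT : IsTriangular P)
    (hchains : ∀ x y : P, x ≤ y → grade ℕ y = grade ℕ x + 3 → numMaxChains x y = 6) (m : ℕ) :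
    HasSemiBooleanIntervals P (2 * m + 3) := by
  induction m with
  | zero =>
    exact hasSemiBooleanIntervals_of_isBooleanInterval fun x y hxy hg =>
      hE.isThin.isBooleanInterval_of_rank_three hxy hg (hchains x y hxy hg)
  | succ m ih =>
    exact hasSemiBooleanIntervals_succ_of_isBooleanInterval (r := 2 * m + 4) (by omega)
      fun _ _ => hE.isBooleanInterval_of_even hT ih (even_two_mul m)

end EvenRank

section OrderIsomorphisms

theorem nonempty_orderIso_of_range_eq {α β γ : Type*} [Preorder α] [Preorder β] [Preorder γ]
    (f : α ↪o γ) (g : β ↪o γ) (h : Set.range f = Set.range g) : Nonempty (α ≃o β) :=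
  ⟨f.orderIso.trans ((OrderIso.setCongr _ _ h).trans g.orderIso.symm)⟩

theorem nonempty_orderIso_withBot_withTop {P M : Type*} [PartialOrder P] [BoundedOrder P]
    [Nontrivial P] [PartialOrder M] (f : {z : P // z ≠ ⊥ ∧ z ≠ ⊤} ≃o M) :
    Nonempty (P ≃o WithBot (WithTop M)) := by
  classical
  let _ : OrderTop {z : P // z ≠ ⊥} := Subtype.orderTop top_ne_bot
  have proper : {z : {z : P // z ≠ ⊥} // z ≠ ⊤} ≃o {z : P // z ≠ ⊥ ∧ z ≠ ⊤} :=
    { toEquiv := (Equiv.subtypeEquivRight fun z => not_congr Subtype.ext_iff).trans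
        (Equiv.subtypeSubtypeEquivSubtypeInter _ fun z => z ≠ ⊤)
      map_rel_iff' := Iff.rfl }
  exact ⟨WithBot.subtypeOrderIso.symm.trans
    (WithTop.subtypeOrderIso.symm.trans (proper.trans f).withTopCongr).withBotCongr⟩

variable {ι α β : Type*} [Fintype α]

theorem map_subset_map_iff_sigma_le (ℓ : ι × α ↪ β)
    (s t : Σ _ : ι, {S : Finset α // S ≠ ⊥ ∧ S ≠ ⊤}) :
    s.2.1.map ((Function.Embedding.sectR s.1 α).trans ℓ) ⊆
      t.2.1.map ((Function.Embedding.sectR t.1 α).trans ℓ) ↔ s ≤ t := by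
  obtain ⟨i, S, hS, hS'⟩ := s
  obtain ⟨j, T, hT⟩ := t
  constructor
  · intro h
    have hmem : ∀ a ∈ S, i = j ∧ a ∈ T := fun a ha => by
      obtain ⟨b, hb, hba⟩ := Finset.mem_map.1 (h (Finset.mem_map_of_mem _ ha))
      obtain ⟨rfl, rfl⟩ := Prod.mk.inj (ℓ.injective hba)
      exact ⟨rfl, hb⟩
    obtain ⟨a, ha⟩ := Finset.nonempty_iff_ne_empty.2 hS
    obtain ⟨rfl, -⟩ := hmem a ha
    exact Sigma.mk_le_mk_iff.2 fun a ha => (hmem a ha).2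
  · rintro ⟨_, _, _, hST⟩
    exact Finset.map_subset_map.2 hST

/-- A disjoint union of copies of the proper part of a boolean lattice, realised inside a single
boolean lattice: the members are the proper nonempty subsets of the blocks `ℓ '' ({i} ×ˢ univ)`. -/
def blockEmbedding (ℓ : ι × α ↪ β) :
    (Σ _ : ι, {S : Finset α // S ≠ ⊥ ∧ S ≠ ⊤}) ↪o Finset β :=
  OrderEmbedding.ofMapLEIff (fun s => s.2.1.map ((Function.Embedding.sectR s.1 α).trans ℓ))
    (map_subset_map_iff_sigma_le ℓ)

theorem mem_range_blockEmbedding {ℓ : ι × α ↪ β} {U : Finset β} :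
    U ∈ Set.range (blockEmbedding ℓ) ↔ ∃ p, ℓ p ∈ U ∧
      U ⊂ Finset.univ.map ((Function.Embedding.sectR p.1 α).trans ℓ) := by
  constructor
  · rintro ⟨⟨i, S, hS, hS'⟩, rfl⟩
    obtain ⟨a, ha⟩ := Finset.nonempty_iff_ne_empty.2 hS
    exact ⟨(i, a), Finset.mem_map_of_mem _ ha,
      Finset.map_ssubset_map.2 (lt_top_iff_ne_top.2 hS')⟩
  · rintro ⟨⟨i, a⟩, ha, hU⟩
    obtain ⟨S, -, rfl⟩ := Finset.subset_map_iff.1 hU.subset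
    refine ⟨⟨i, S, ?_, lt_top_iff_ne_top.1 (Finset.map_ssubset_map.1 hU)⟩, rfl⟩
    rintro rfl
    exact Finset.notMem_empty _ ha

theorem map_univ_equiv_trans_subtype {s : Finset β} (e : α ≃ s) :
    Finset.univ.map (e.toEmbedding.trans (Function.Embedding.subtype _)) = s := by
  rw [← Finset.map_map, Finset.map_univ_equiv, Finset.univ_eq_attach, Finset.attach_map_val]

theorem exists_equiv_fin_prod_fin {X : Type*} [Finite X] (r : Setoid X) {n : ℕ}
    (hr : ∀ a, Nat.card {b // r b a} = n) :
    ∃ (k : ℕ) (e : Fin k × Fin n ≃ X), ∀ p q, r (e p) (e q) ↔ p.1 = q.1 := by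
  have hfiber : ∀ c : Quotient r, Nonempty ({a // Quotient.mk r a = c} ≃ Fin n) := by
    refine Quotient.ind fun a => ⟨?_⟩
    exact (Equiv.subtypeEquivRight fun b => Quotient.eq).trans (Finite.equivFinOfCardEq (hr a))
  let e : X ≃ Fin (Nat.card (Quotient r)) × Fin n :=
    (((Equiv.sigmaFiberEquiv (Quotient.mk r)).symm.trans
      (Equiv.sigmaCongrRight fun c => (hfiber c).some)).trans
      (Equiv.sigmaEquivProd _ _)).trans ((Finite.equivFin _).prodCongr (Equiv.refl _))
  have he : ∀ a, (e a).1 = Finite.equivFin _ (Quotient.mk r a) := fun _ => rfl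
  refine ⟨Nat.card (Quotient r), e.symm, fun p q => ?_⟩
  rw [← Quotient.eq, ← (Finite.equivFin (Quotient r)).apply_eq_iff_eq, ← he, ← he,
    e.apply_symm_apply, e.apply_symm_apply]

end OrderIsomorphisms

section Classification

variable {P : Type*} [PartialOrder P] [Fintype P]

theorem IsBooleanInterval.nonempty_orderIso [BoundedOrder P] (h : IsBooleanInterval (⊥ : P) ⊤)
    {n : ℕ} (hn : (intervalAtoms (⊥ : P) ⊤).card = n) : Nonempty (P ≃o BooleanLattice n) := by
  let ℓ : Fin n ↪ P :=
    (Finset.equivFinOfCardEq hn).symm.toEmbedding.trans (Function.Embedding.subtype _)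
  have hℓ : Finset.univ.map ℓ = intervalAtoms ⊥ ⊤ := map_univ_equiv_trans_subtype _
  let f : P ↪o Finset P := OrderEmbedding.ofMapLEIff (intervalAtoms ⊥) fun z w =>
    ⟨h.le_of_intervalAtoms_subset z ⟨bot_le, le_top⟩ w ⟨bot_le, le_top⟩, intervalAtoms_mono⟩
  refine nonempty_orderIso_of_range_eq f (Finset.mapEmbedding ℓ) (Set.ext fun T => ?_)
  calc T ∈ Set.range f ↔ T ⊆ intervalAtoms ⊥ ⊤ :=
        ⟨fun ⟨z, hz⟩ => hz ▸ intervalAtoms_mono le_top, fun hT =>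
          (h.exists_intervalAtoms_eq T hT).imp fun _ => And.right⟩
    _ ↔ T ∈ Set.range (Finset.mapEmbedding ℓ) := by
        rw [← hℓ, Finset.subset_map_iff]
        simp only [Finset.subset_univ, true_and, Set.mem_range, Finset.mapEmbedding_apply, eq_comm]

namespace IsSemiBooleanInterval

variable [GradeOrder ℕ P] {x y : P} {n : ℕ}

theorem exists_mem_Ioo_intervalAtoms_eq_iff (h : IsSemiBooleanInterval x y)
    (hg : grade ℕ x + 4 ≤ grade ℕ y) {T : Finset P} :
    (∃ z ∈ Set.Ioo x y, intervalAtoms x z = T) ↔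
      ∃ v ∈ intervalAtoms x y, v ∈ T ∧ T ⊂ atomClass x y v := by
  constructor
  · rintro ⟨z, hz, rfl⟩
    obtain ⟨v, hv⟩ := intervalAtoms_nonempty hz.1
    have hvy := intervalAtoms_mono hz.2.le hv
    exact ⟨v, hvy, hv, h.intervalAtoms_ssubset_atomClass hg hvy ⟨(mem_intervalAtoms.1 hv).2, hz.2⟩⟩
  · rintro ⟨v, hv, hvT, hT⟩
    obtain ⟨z, hz, hz_eq⟩ := h.exists_intervalAtoms_eq hg hv hvT hT
    exact ⟨z, ⟨(mem_intervalAtoms.1 hv).1.lt.trans_le hz.1, hz.2⟩, hz_eq⟩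

theorem exists_embedding_atomClass_eq (h : IsSemiBooleanInterval x y) (hn : 4 ≤ n)
    (hg : grade ℕ y = grade ℕ x + n) :
    ∃ (k : ℕ) (ℓ : Fin k × Fin n ↪ P), Finset.univ.map ℓ = intervalAtoms x y ∧ ∀ p,
      atomClass x y (ℓ p) = Finset.univ.map ((Function.Embedding.sectR p.1 (Fin n)).trans ℓ) := by
  classical
  have hg' : grade ℕ x + 4 ≤ grade ℕ y := by omega
  let r : Setoid (intervalAtoms x y) := Setoid.ker fun v => atomClass x y v
  have hr : ∀ v w, r w v ↔ (w : P) ∈ atomClass x y v := fun v w =>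
    eq_comm.trans (h.atomClass_eq_iff hg' v.2 w.2)
  have hcard : ∀ v, Nat.card {w // r w v} = n := fun v => calc
    Nat.card {w // r w v} = Nat.card (atomClass x y (v : P)) :=
      Nat.card_congr ((Equiv.subtypeEquivRight (hr v)).trans
        (Equiv.subtypeSubtypeEquivSubtype fun hw => atomClass_subset hw))
    _ = n := by
      have := h.card_atomClass_add_grade hg' v.2
      rw [Nat.card_eq_finsetCard]
      omega
  obtain ⟨k, e, he⟩ := exists_equiv_fin_prod_fin r hcard
  refine ⟨k, e.toEmbedding.trans (Function.Embedding.subtype _), map_univ_equiv_trans_subtype e,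
    fun p => Finset.Subset.antisymm (fun w hw => ?_) fun w hw => ?_⟩
  · obtain ⟨q, hq⟩ := e.surjective ⟨w, atomClass_subset hw⟩
    have hqp : q.1 = p.1 := (he q p).1 (hq ▸ (hr (e p) ⟨w, _⟩).2 hw)
    exact Finset.mem_map.2 ⟨q.2, Finset.mem_univ _, hqp ▸ congrArg Subtype.val hq⟩
  · obtain ⟨j, -, rfl⟩ := Finset.mem_map.1 hw
    exact (hr (e p) (e (p.1, j))).1 ((he (p.1, j) p).2 rfl)

theorem nonempty_orderIso [BoundedOrder P] (h : IsSemiBooleanInterval (⊥ : P) ⊤) (hn : 4 ≤ n)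
    (hg : grade ℕ (⊤ : P) = grade ℕ (⊥ : P) + n) :
    ∃ k, 1 ≤ k ∧ Nonempty (P ≃o KSum k (BooleanLattice n)) := by
  have hg' : grade ℕ (⊥ : P) + 4 ≤ grade ℕ (⊤ : P) := by omega
  have hlt : (⊥ : P) < ⊤ := lt_of_le_of_grade_lt bot_le (by omega)
  have : Nontrivial P := ⟨⊥, ⊤, hlt.ne⟩
  obtain ⟨k, ℓ, hℓ, hclass⟩ := h.exists_embedding_atomClass_eq hn hg
  have hk : 1 ≤ k := by
    obtain ⟨v, hv⟩ := intervalAtoms_nonempty hlt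
    obtain ⟨p, -, -⟩ := Finset.mem_map.1 (hℓ ▸ hv)
    exact p.1.pos
  let f : {z : P // z ≠ ⊥ ∧ z ≠ ⊤} ↪o Finset P :=
    OrderEmbedding.ofMapLEIff (fun z => intervalAtoms ⊥ z.1) fun z w =>
      ⟨h.le_of_intervalAtoms_subset hg' ⟨bot_le, z.2.2.lt_top⟩ ⟨bot_le, w.2.2.lt_top⟩,
        fun hzw => intervalAtoms_mono hzw⟩
  have hrange : Set.range f = Set.range (blockEmbedding ℓ) := by
    ext T
    calc T ∈ Set.range f ↔ ∃ z ∈ Set.Ioo ⊥ ⊤, intervalAtoms ⊥ z = T := by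
          simp only [f, Set.mem_range, Subtype.exists, OrderEmbedding.coe_ofMapLEIff, Set.mem_Ioo,
            bot_lt_iff_ne_bot, lt_top_iff_ne_top, exists_prop]
      _ ↔ ∃ v ∈ intervalAtoms ⊥ ⊤, v ∈ T ∧ T ⊂ atomClass ⊥ ⊤ v :=
          h.exists_mem_Ioo_intervalAtoms_eq_iff hg'
      _ ↔ ∃ p, ℓ p ∈ T ∧ T ⊂ atomClass ⊥ ⊤ (ℓ p) := by
          simp only [← hℓ, Finset.mem_map, Finset.mem_univ, true_and, exists_exists_eq_and]
      _ ↔ T ∈ Set.range (blockEmbedding ℓ) := by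
          simp only [hclass, mem_range_blockEmbedding]
  obtain ⟨g⟩ := nonempty_orderIso_of_range_eq f (blockEmbedding ℓ) hrange
  exact ⟨k, hk, nonempty_orderIso_withBot_withTop g⟩

end IsSemiBooleanInterval

end Classification

theorem mainTheorem8 {P : Type*} [PartialOrder P] [BoundedOrder P] [Finite P] [GradeMinOrder ℕ P]
    (n : ℕ) (hn : 4 ≤ n) (hrank : grade ℕ (⊤ : P) = n)
    (hE : IsEulerian P) (hT : IsTriangular P)
    (h6 : ∀ x y : P, x ≤ y → grade ℕ y = grade ℕ x + 3 → numMaxChains x y = 6) :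
    (Odd n → ∃ α : ℕ, 1 ≤ α ∧ Nonempty (P ≃o KSum α (BooleanLattice n))) ∧
      (Even n → Nonempty (P ≃o BooleanLattice n)) := by
  have := Fintype.ofFinite P
  have hg : grade ℕ (⊤ : P) = grade ℕ (⊥ : P) + n := by
    rw [hrank, grade_bot, Nat.bot_eq_zero, zero_add]
  have hodd := hE.hasSemiBooleanIntervals_odd hT h6
  constructor
  · rintro ⟨m, rfl⟩
    obtain ⟨k, rfl⟩ := Nat.exists_eq_add_of_le' (show 1 ≤ m by omega)
    exact (hodd k ⊥ ⊤ bot_le hg).1.nonempty_orderIso hn hg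
  · intro heven
    obtain ⟨m, rfl⟩ := Nat.exists_eq_add_of_le' hn
    obtain ⟨k, rfl⟩ := even_iff_two_dvd.1 ((Nat.even_add.1 heven).2 (by decide))
    have hB := hE.isBooleanInterval_of_even hT (hodd k) (even_two_mul k) bot_le hg
    exact hB.nonempty_orderIso (by have := hB.card_intervalAtoms_add_grade; omega)
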